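/- Let $n, N\ge 0$ and let $\lambda=(\lambda_1,\dots,\lambda_n)$ be a partition with $N\ge\lambda_1\ge\cdots\ge\lambda_n>0$. Let $\sigma,w\in S_n$, let $w_0\in S_n$ be the longest element $i\mapsto n+1-i$, and let $\ell$ be the length (number of inversions) on $S_n$. **Lattice model.** Take a rectangular grid with $n$ rows, numbered $1,\dots,n$ from top to bottom, and $N$ columns, numbered $1,\dots,N$ from right to left; the vertex in row $i$ and column $j$ has row parameter $x_i$ and column parameter $y_j$. There are $n$ colors $1<2<\cdots<n$. A horizontal edge is decorated by a color or by $\oplus$ (no color), a vertical edge by a set of colors. Write $(L,\Sigma,R,B)$ for the decorations of the left, top, right and bottom edge at a vertex with parameters $x,y$, and $\Sigma_I$ for the number of elements of $\Sigma$ in the interval $I$ of colors (so $\Sigma_c=1$ if $c\in\Sigma$ and $\Sigma_c=0$ otherwise). The admissible vertices and their Boltzmann weights are, for colors $c<d$ in cases 5 and 6, 1. $(\oplus,\Sigma,\oplus,\Sigma)$: $(-t)^{|\Sigma|}$; 2. $(c,\Sigma,c,\Sigma)$: $t^{\Sigma_{(c,n]}}\left(-\tfrac{x}{y}+t^{\Sigma_c}\right)$;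 3. $(\oplus,\Sigma,c,\Sigma\setminus\{c\})$ with $c\in\Sigma$: $(-t)^{\Sigma_{[1,c)}}\,t^{\Sigma_{(c,n]}}$; 4. $(c,\Sigma,\oplus,\Sigma\cup\{c\})$ with $c\notin\Sigma$: $(t-1)\tfrac{x}{y}\,(-t)^{\Sigma_{(c,n]}}$; 5. $(c,\Sigma,d,(\Sigma\cup\{c\})\setminus\{d\})$ with $c\notin\Sigma$, $d\in\Sigma$: $(t-1)\tfrac{x}{y}\,(-t)^{\Sigma_{(c,d)}}\,t^{\Sigma_{(d,n]}}$; 6. $(d,\Sigma,c,(\Sigma\cup\{d\})\setminus\{c\})$ with $d\notin\Sigma$, $c\in\Sigma$: $(t-1)(-1)^{\Sigma_{(c,d)}}\,t^{\Sigma_{(d,n]}}$. The boundary conditions are: the top edge of column $j$ carries the set of colors $\{\sigma(n+1-i) : \lambda_i=j\}$; the right edge of row $i$ has color $w(i)$; all left and bottom boundary edges are uncolored. The partition function $Z^\lambda_{\sigma,w}(\boldsymbol x;\boldsymbol y)$ is the sum, over all decorations of the grid with these boundary decorations all of whose vertices are admissible, of the product of the Boltzmann weights of the vertices. **Operators.**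 On $\mathbb C(t)(x_1,\dots,x_n;y_1,\dots,y_N)$ let, for $1\le i<n$ and with $\boldsymbol x^{\alpha_i}=x_i/x_{i+1}$, $$\tau_i f=\frac{t-1}{1-\boldsymbol x^{\alpha_i}}\,f+\frac{\boldsymbol x^{\alpha_i}-t}{1-\boldsymbol x^{\alpha_i}}\,s_if,$$ where $s_i$ exchanges $x_i$ and $x_{i+1}$ and fixes $\boldsymbol y$ and $t$. These operators are invertible. For $v\in S_n$ put $\tau_v=\tau_{i_1}\cdots\tau_{i_\ell}$, where $v=s_{i_1}\cdots s_{i_\ell}$ is any reduced decomposition. **Theorem.** Suppose that $\sigma$ has maximal length in its left coset $\sigma\,\mathrm{Stab}(w_0\cdot\lambda)$, where $w_0\cdot\lambda=(\lambda_n,\dots,\lambda_1)$ and $\mathrm{Stab}(w_0\cdot\lambda)\subseteq S_n$ is its stabilizer. Then $$Z^\lambda_{\sigma,w}(\boldsymbol x;\boldsymbol y)=t^{\ell(\sigma)}\,\tau_w^{-1}\,\tau_{\sigma w_0}\cdot\left[\prod_{i=1}^n\prod_{1\le j<\lambda_i}\left(1-\frac{x_i}{y_j}\right)\right],$$ for every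 choice of the reduced decompositions of $w$ and $\sigma w_0$ used to form $\tau_w$ and $\tau_{\sigma w_0}$. -/

import Mathlib

/-!
The coloured lattice model with `n` rows, `N` columns and `n` colours, and the Demazure-type
operators `τ_i`.

All indices are zero-based: the row with variable `x_i`, `1 ≤ i ≤ n`, counted from top to bottom, is
`i - 1 : Fin n`; the column with variable `y_j`, `1 ≤ j ≤ N`, counted from right to left, is
`j - 1 : Fin N`; the colour `c_k` is `k - 1 : Fin n`. The parts of a partition are not shifted.
-/

namespace DoubleWhittaker

noncomputable section

/-- The field `ℂ(t)(x_1, …, x_n; y_1, …, y_N)`. -/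
abbrev K (n N : ℕ) : Type := FractionRing (MvPolynomial (Fin n ⊕ Fin N) (RatFunc ℂ))

/-- The global parameter `t`. -/
def t (n N : ℕ) : K n N := algebraMap (RatFunc ℂ) (K n N) RatFunc.X

/-- The row variables `x_i`. -/
def x {n N : ℕ} (i : Fin n) : K n N :=
  algebraMap (MvPolynomial (Fin n ⊕ Fin N) (RatFunc ℂ)) (K n N) (MvPolynomial.X (Sum.inl i))

/-- The column variables `y_j`. -/
def y {n N : ℕ} (j : Fin N) : K n N :=
  algebraMap (MvPolynomial (Fin n ⊕ Fin N) (RatFunc ℂ)) (K n N) (MvPolynomial.X (Sum.inr j))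

/-! ### The symmetric group -/

/-- The length of a permutation: its number of inversions. -/
def len {n : ℕ} (w : Equiv.Perm (Fin n)) : ℕ :=
  (Finset.univ.filter (fun p : Fin n × Fin n => p.1 < p.2 ∧ w p.2 < w p.1)).card

/-- The positions `i` and `i + 1` exchanged by the simple reflection `s_i`. -/
def lo {n : ℕ} (i : Fin (n - 1)) : Fin n := ⟨i, by omega⟩

/-- See `lo`. -/
def hi {n : ℕ} (i : Fin (n - 1)) : Fin n := ⟨i + 1, by omega⟩

/-- The simple reflection `s_i = (i, i + 1)`. -/
def simpleRefl {n : ℕ} (i : Fin (n - 1)) : Equiv.Perm (Fin n) := Equiv.swap (lo i) (hi i)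

/-- `a = [i_1, …, i_ℓ]` is a reduced decomposition `w = s_{i_1} ⋯ s_{i_ℓ}`. -/
def IsReducedWord {n : ℕ} (w : Equiv.Perm (Fin n)) (a : List (Fin (n - 1))) : Prop :=
  (a.map simpleRefl).prod = w ∧ a.length = len w

theorem lo_ne_hi {n : ℕ} (i : Fin (n - 1)) : lo i ≠ hi i := by
  intro h
  have := congrArg Fin.val h
  simp [lo, hi] at this

theorem len_mul_simpleRefl {n : ℕ} (w : Equiv.Perm (Fin n)) (i : Fin (n - 1))
    (h : w (hi i) < w (lo i)) : len w = len (w * simpleRefl i) + 1 := by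
  have hlt : lo i < hi i := by simp [lo, hi, Fin.lt_def]
  have hmem : (lo i, hi i) ∈
      Finset.univ.filter (fun p : Fin n × Fin n => p.1 < p.2 ∧ w p.2 < w p.1) := by
    simp [hlt, h]
  unfold len
  rw [← Finset.card_erase_add_one hmem]
  congr 1
  have hs : ∀ k : Fin n, (simpleRefl i k : Fin n) =
      if k = lo i then hi i else if k = hi i then lo i else k := fun k => by
    unfold simpleRefl; rw [Equiv.swap_apply_def]
  have hlo : ∀ k : Fin n, k = lo i ↔ (k : ℕ) = i := fun k => by simp [lo, Fin.ext_iff]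
  have hhi : ∀ k : Fin n, k = hi i ↔ (k : ℕ) = i + 1 := fun k => by simp [hi, Fin.ext_iff]
  have hinv : ∀ k, simpleRefl i (simpleRefl i k) = k := fun k => by simp [simpleRefl]
  have hmono : ∀ p q : Fin n, p < q → ¬ (p = lo i ∧ q = hi i) →
      simpleRefl i p < simpleRefl i q := by
    intro p q hpq hne
    rw [hs, hs]
    rw [hlo, hhi] at hne
    simp only [hlo, hhi]
    rw [Fin.lt_def] at hpq ⊢
    split_ifs <;> simp [lo, hi] <;> omega
  refine Finset.card_nbij' (fun p => (simpleRefl i p.1, simpleRefl i p.2))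
    (fun p => (simpleRefl i p.1, simpleRefl i p.2)) ?_ ?_ ?_ ?_
  · rintro ⟨p, q⟩ hp
    simp only [Finset.mem_coe, Finset.mem_erase, Finset.mem_filter, Finset.mem_univ, true_and,
      ne_eq, Prod.mk.injEq] at hp
    simp only [Finset.mem_coe, Finset.mem_filter, Finset.mem_univ, true_and]
    simp only [Equiv.Perm.mul_apply, hinv]
    exact ⟨hmono p q hp.2.1 hp.1, hp.2.2⟩
  · rintro ⟨p, q⟩ hp
    simp only [Finset.mem_coe, Finset.mem_filter, Finset.mem_univ, true_and] at hp
    simp only [Equiv.Perm.mul_apply] at hp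
    have hne : ¬ (p = lo i ∧ q = hi i) := by
      rintro ⟨rfl, rfl⟩
      have := hp.2
      simp only [simpleRefl, Equiv.swap_apply_left, Equiv.swap_apply_right] at this
      exact absurd h (not_lt.2 this.le)
    simp only [Finset.mem_coe, Finset.mem_erase, Finset.mem_filter, Finset.mem_univ, true_and,
      ne_eq, Prod.mk.injEq]
    refine ⟨?_, hmono p q hp.1 hne, hp.2⟩
    rintro ⟨h1, h2⟩
    have e1 : p = hi i := by rw [← hinv p, h1]; simp [simpleRefl]
    have e2 : q = lo i := by rw [← hinv q, h2]; simp [simpleRefl]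
    rw [e1, e2] at hp
    exact absurd hp.1 (not_lt.2 hlt.le)
  · rintro ⟨p, q⟩ -
    simp [hinv]
  · rintro ⟨p, q⟩ -
    simp [hinv]

/-- Every permutation has a reduced decomposition. -/
theorem exists_isReducedWord {n : ℕ} (w : Equiv.Perm (Fin n)) : ∃ a, IsReducedWord w a := by
  induction hk : len w using Nat.strong_induction_on generalizing w with
  | _ k ih =>
    by_cases hd : ∃ i : Fin (n - 1), w (hi i) < w (lo i)
    · obtain ⟨i, hi'⟩ := hd
      have hl := len_mul_simpleRefl w i hi'
      obtain ⟨a, ha1, ha2⟩ := ih (len (w * simpleRefl i)) (by omega) _ rfl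
      refine ⟨a ++ [i], ?_, ?_⟩
      · rw [List.map_append, List.prod_append, ha1]
        simp [mul_assoc, simpleRefl]
      · rw [List.length_append, ha2, hl]; rfl
    · push Not at hd
      have hmono : Monotone w := by
        obtain _ | m := n
        · exact fun a => a.elim0
        · exact Fin.monotone_iff_le_succ.2 fun i => hd i
      have hw : w = 1 := by
        have hsm : StrictMono w := hmono.strictMono_of_injective w.injective
        have h2 : (hsm.orderIsoOfSurjective w w.surjective) = OrderIso.refl _ :=
          Subsingleton.elim _ _
        ext k
        exact congrArg Fin.val (congrArg (fun e : Fin n ≃o Fin n => e k) h2)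
      refine ⟨[], ?_, ?_⟩
      · simp [hw]
      · symm
        rw [List.length_nil, len, Finset.card_eq_zero, Finset.filter_eq_empty_iff]
        rintro ⟨p, q⟩ -
        simp only [hw, Equiv.Perm.one_apply]
        exact fun h => absurd h.1 (not_lt.2 h.2.le)

/-- The longest element `w_0`, `i ↦ n + 1 - i`. -/
def longest (n : ℕ) : Equiv.Perm (Fin n) := Fin.revPerm

/-- `u` lies in the stabilizer of `w_0 · lam = (lam_n, …, lam_1)`. -/
def StabilizesRev {n : ℕ} (lam : Fin n → ℕ) (u : Equiv.Perm (Fin n)) : Prop :=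
  ∀ i, lam (longest n (u i)) = lam (longest n i)

/-- `σ` has maximal length in its left coset `σ · Stab(w_0 · lam)`. -/
def IsMaxCosetRep {n : ℕ} (lam : Fin n → ℕ) (σ : Equiv.Perm (Fin n)) : Prop :=
  ∀ u, StabilizesRev lam u → len (σ * u) ≤ len σ

/-! ### The operators `τ_i` -/

/-- A permutation of the row variables, as an automorphism of the field that fixes `t` and
all column variables. -/
def permX {n : ℕ} (N : ℕ) (w : Equiv.Perm (Fin n)) : K n N ≃ₐ[RatFunc ℂ] K n N :=
  IsFractionRing.fieldEquivOfAlgEquiv (RatFunc ℂ) (K n N) (K n N)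
    (MvPolynomial.renameEquiv (RatFunc ℂ) (Equiv.sumCongr w (Equiv.refl (Fin N))))

/-- `x^{α_i} = x_i / x_{i+1}`. -/
def xroot {n : ℕ} (N : ℕ) (i : Fin (n - 1)) : K n N := x (lo i) / x (hi i)

/-- The operator `τ_i`,
`τ_i f = (t - 1) / (1 - x^{α_i}) f + (x^{α_i} - t) / (1 - x^{α_i}) s_i f`. -/
def tauFun {n : ℕ} (N : ℕ) (i : Fin (n - 1)) (f : K n N) : K n N :=
  (t n N - 1) / (1 - xroot N i) * f
    + (xroot N i - t n N) / (1 - xroot N i) * permX N (simpleRefl i) f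

/-- The inverse of `τ_i`. -/
def tauInvFun {n : ℕ} (N : ℕ) (i : Fin (n - 1)) (f : K n N) : K n N :=
  (t n N - 1) * xroot N i / (t n N * (1 - xroot N i)) * f
    + (xroot N i - t n N) / (t n N * (1 - xroot N i)) * permX N (simpleRefl i) f

theorem t_ne_zero (n N : ℕ) : t n N ≠ 0 := by
  unfold t
  intro h
  exact RatFunc.X_ne_zero ((map_eq_zero _).1 h)

theorem x_ne_zero {n N : ℕ} (i : Fin n) : (x i : K n N) ≠ 0 := by
  unfold x
  intro h
  exact MvPolynomial.X_ne_zero _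
    ((map_eq_zero_iff _ (IsFractionRing.injective _ (K n N))).1 h)

theorem x_injective {n N : ℕ} : Function.Injective (x : Fin n → K n N) := by
  intro i j h
  have h1 := IsFractionRing.injective (MvPolynomial (Fin n ⊕ Fin N) (RatFunc ℂ)) (K n N) h
  exact Sum.inl_injective (MvPolynomial.X_injective h1)

theorem permX_x {n N : ℕ} (w : Equiv.Perm (Fin n)) (i : Fin n) :
    permX N w (x i) = x (w i) := by
  unfold permX x
  rw [IsFractionRing.fieldEquivOfAlgEquiv_algebraMap]
  simp

theorem permX_y {n N : ℕ} (w : Equiv.Perm (Fin n)) (j : Fin N) :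
    permX N w (y j) = y j := by
  unfold permX y
  rw [IsFractionRing.fieldEquivOfAlgEquiv_algebraMap]
  simp

theorem permX_t {n N : ℕ} (w : Equiv.Perm (Fin n)) : permX N w (t n N) = t n N :=
  (permX N w).commutes _

theorem permX_simpleRefl_sq {n N : ℕ} (i : Fin (n - 1)) (f : K n N) :
    permX N (simpleRefl i) (permX N (simpleRefl i) f) = f := by
  obtain ⟨p, q, -, rfl⟩ :=
    IsFractionRing.div_surjective (A := MvPolynomial (Fin n ⊕ Fin N) (RatFunc ℂ)) f
  have key : ∀ p : MvPolynomial (Fin n ⊕ Fin N) (RatFunc ℂ),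
      permX N (simpleRefl i) (permX N (simpleRefl i) (algebraMap _ (K n N) p))
        = algebraMap _ (K n N) p := by
    intro p
    unfold permX
    rw [IsFractionRing.fieldEquivOfAlgEquiv_algebraMap,
      IsFractionRing.fieldEquivOfAlgEquiv_algebraMap]
    congr 1
    rw [MvPolynomial.renameEquiv_apply, MvPolynomial.renameEquiv_apply, MvPolynomial.rename_rename]
    have h : (⇑((simpleRefl i).sumCongr (Equiv.refl (Fin N))) ∘
        ⇑((simpleRefl i).sumCongr (Equiv.refl (Fin N)))) = id := by
      funext s
      rcases s with s | s <;> simp [simpleRefl]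
    rw [h, MvPolynomial.rename_id_apply]
  rw [map_div₀, map_div₀, key, key]

theorem xroot_ne_zero {n N : ℕ} (i : Fin (n - 1)) : xroot N i ≠ 0 :=
  div_ne_zero (x_ne_zero _) (x_ne_zero _)

theorem one_sub_xroot_ne_zero {n N : ℕ} (i : Fin (n - 1)) : 1 - xroot N i ≠ 0 := by
  intro h
  have h1 : x (lo i) / x (hi i) = (1 : K n N) := (sub_eq_zero.1 h).symm
  rw [div_eq_one_iff_eq (x_ne_zero _)] at h1
  exact lo_ne_hi i (x_injective h1)

theorem permX_xroot {n N : ℕ} (i : Fin (n - 1)) :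
    permX N (simpleRefl i) (xroot N i) = (xroot N i)⁻¹ := by
  unfold xroot
  rw [map_div₀, permX_x, permX_x, inv_div]
  simp [simpleRefl]

theorem tau_left_aux {F : Type*} [Field F] {t q f g : F} (ht : t ≠ 0) (hq : q ≠ 0)
    (hq1 : 1 - q ≠ 0) :
    (t - 1) * q / (t * (1 - q)) * ((t - 1) / (1 - q) * f + (q - t) / (1 - q) * g)
      + (q - t) / (t * (1 - q))
        * ((t - 1) / (1 - q⁻¹) * g + (q⁻¹ - t) / (1 - q⁻¹) * f) = f := by
  have h2 : q - 1 ≠ 0 := fun h => hq1 (by linear_combination -h)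
  have e : 1 - q⁻¹ = (q - 1) / q := by field_simp
  rw [e]
  have e2 : q⁻¹ - t = (1 - t * q) / q := by field_simp
  rw [e2]
  have e3 : 1 - q = -(q - 1) := by ring
  rw [e3]
  field_simp
  ring

theorem tau_right_aux {F : Type*} [Field F] {t q f g : F} (ht : t ≠ 0) (hq : q ≠ 0)
    (hq1 : 1 - q ≠ 0) :
    (t - 1) / (1 - q) * ((t - 1) * q / (t * (1 - q)) * f + (q - t) / (t * (1 - q)) * g)
      + (q - t) / (1 - q)
        * ((t - 1) * q⁻¹ / (t * (1 - q⁻¹)) * g + (q⁻¹ - t) / (t * (1 - q⁻¹)) * f) = f := by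
  have h2 : q - 1 ≠ 0 := fun h => hq1 (by linear_combination -h)
  have e : 1 - q⁻¹ = (q - 1) / q := by field_simp
  rw [e]
  have e2 : q⁻¹ - t = (1 - t * q) / q := by field_simp
  rw [e2]
  have e3 : 1 - q = -(q - 1) := by ring
  rw [e3]
  field_simp
  ring

theorem tauInvFun_tauFun {n N : ℕ} (i : Fin (n - 1)) (f : K n N) :
    tauInvFun N i (tauFun N i f) = f := by
  unfold tauInvFun tauFun
  simp only [map_add, map_mul, map_div₀, map_sub, map_one, permX_t, permX_xroot,
    permX_simpleRefl_sq]
  exact tau_left_aux (t_ne_zero n N) (xroot_ne_zero i) (one_sub_xroot_ne_zero i)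

theorem tauFun_tauInvFun {n N : ℕ} (i : Fin (n - 1)) (f : K n N) :
    tauFun N i (tauInvFun N i f) = f := by
  unfold tauInvFun tauFun
  simp only [map_add, map_mul, map_div₀, map_sub, map_one, permX_t, permX_xroot,
    permX_simpleRefl_sq]
  exact tau_right_aux (t_ne_zero n N) (xroot_ne_zero i) (one_sub_xroot_ne_zero i)

/-- The operator `τ_i` as an invertible `ℂ(t)`-linear operator. -/
def tau {n : ℕ} (N : ℕ) (i : Fin (n - 1)) : K n N ≃ₗ[RatFunc ℂ] K n N where
  toFun := tauFun N i
  invFun := tauInvFun N i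
  left_inv := tauInvFun_tauFun i
  right_inv := tauFun_tauInvFun i
  map_add' f g := by
    unfold tauFun
    rw [map_add]
    ring
  map_smul' c f := by
    have h : permX N (simpleRefl i) (c • f) = c • permX N (simpleRefl i) f :=
      (permX N (simpleRefl i)).toLinearEquiv.map_smul c f
    unfold tauFun
    rw [h, RingHom.id_apply, smul_add, mul_smul_comm, mul_smul_comm]

/-- `τ_{i_1} ⋯ τ_{i_ℓ}` for `a = [i_1, …, i_ℓ]`. It is `τ_w` when `a` is a reduced decomposition
of `w`. -/
def tauWord {n : ℕ} (N : ℕ) (a : List (Fin (n - 1))) : K n N ≃ₗ[RatFunc ℂ] K n N :=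
  (a.map (tau N)).prod

/-! ### Boltzmann weights

A vertex is described by the decorations `l` (left), `S` (top), `r` (right), `B` (bottom) of its
adjacent edges; `none` is the uncoloured horizontal edge. -/

/-- The six admissible kinds of vertices. -/
inductive AdmissibleVertex {n : ℕ} :
    Option (Fin n) → Finset (Fin n) → Option (Fin n) → Finset (Fin n) → Prop
  | case1 (S : Finset (Fin n)) : AdmissibleVertex none S none S
  | case2 (S : Finset (Fin n)) (c : Fin n) : AdmissibleVertex (some c) S (some c) S
  | case3 (S : Finset (Fin n)) (c : Fin n) (hc : c ∈ S) :
      AdmissibleVertex none S (some c) (S.erase c)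
  | case4 (S : Finset (Fin n)) (c : Fin n) (hc : c ∉ S) :
      AdmissibleVertex (some c) S none (insert c S)
  | case5 (S : Finset (Fin n)) (c d : Fin n) (hcd : c < d) (hc : c ∉ S) (hd : d ∈ S) :
      AdmissibleVertex (some c) S (some d) ((insert c S).erase d)
  | case6 (S : Finset (Fin n)) (c d : Fin n) (hcd : c < d) (hd : d ∉ S) (hc : c ∈ S) :
      AdmissibleVertex (some d) S (some c) ((insert d S).erase c)

/-- `|Σ_{(c, r]}|`, the number of colours in `S` above `c`. -/
def above {n : ℕ} (S : Finset (Fin n)) (c : Fin n) : ℕ := (S.filter (fun e => c < e)).card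

/-- `|Σ_{[1, c)}|`, the number of colours in `S` below `c`. -/
def below {n : ℕ} (S : Finset (Fin n)) (c : Fin n) : ℕ := (S.filter (fun e => e < c)).card

/-- `|Σ_{(c, d)}|`, the number of colours in `S` strictly between `c` and `d`. -/
def between {n : ℕ} (S : Finset (Fin n)) (c d : Fin n) : ℕ :=
  (S.filter (fun e => c < e ∧ e < d)).card

/-- The Boltzmann weight of an admissible vertex with row parameter `X` and column parameter `Y`.
At an admissible vertex the bottom decoration is determined by the other three. -/
def vertexWeight {n N : ℕ} (X Y : K n N) (S : Finset (Fin n)) :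
    Option (Fin n) → Option (Fin n) → K n N
  | none, none => (-t n N) ^ S.card
  | none, some c => (-t n N) ^ below S c * t n N ^ above S c
  | some c, none => (t n N - 1) * (X / Y) * (-t n N) ^ above S c
  | some a, some b =>
      if a = b then
        t n N ^ above S a * (-(X / Y) + t n N ^ (if a ∈ S then 1 else 0))
      else if a < b then
        (t n N - 1) * (X / Y) * (-t n N) ^ between S a b * t n N ^ above S b
      else
        (t n N - 1) * (-1) ^ between S b a * t n N ^ above S a

/-! ### States and partition functions -/

/-- A decorated `n × N` grid. `hor i k` decorates the horizontal edge of row `i` that has exactly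
`k` columns to its right, so `k = 0` is the right and `k = N` the left boundary; `ver k j` decorates
the vertical edge of column `j` that has exactly `k` rows above it, so `k = 0` is the top and
`k = n` the bottom boundary. -/
@[ext]
structure Decoration (n N : ℕ) where
  hor : Fin n → Fin (N + 1) → Option (Fin n)
  ver : Fin (n + 1) → Fin N → Finset (Fin n)

/-- Decorated grids as pairs of functions. -/
def decorationEquiv (n N : ℕ) : Decoration n N ≃
    (Fin n → Fin (N + 1) → Option (Fin n)) × (Fin (n + 1) → Fin N → Finset (Fin n)) where
  toFun s := (s.hor, s.ver)
  invFun p := ⟨p.1, p.2⟩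
  left_inv _ := rfl
  right_inv _ := rfl

instance (n N : ℕ) : Fintype (Decoration n N) := Fintype.ofEquiv _ (decorationEquiv n N).symm

/-- Decorations of the boundary edges of an `n × N` grid. -/
structure Boundary (n N : ℕ) where
  top : Fin N → Finset (Fin n)
  bottom : Fin N → Finset (Fin n)
  left : Fin n → Option (Fin n)
  right : Fin n → Option (Fin n)

/-- `s` is an admissible state with boundary decorations `B`. -/
def IsState {n N : ℕ} (B : Boundary n N) (s : Decoration n N) : Prop :=
  (∀ j, s.ver 0 j = B.top j) ∧ (∀ j, s.ver (Fin.last n) j = B.bottom j) ∧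
  (∀ i, s.hor i (Fin.last N) = B.left i) ∧ (∀ i, s.hor i 0 = B.right i) ∧
  ∀ i j, AdmissibleVertex (s.hor i j.succ) (s.ver i.castSucc j) (s.hor i j.castSucc)
    (s.ver i.succ j)

/-- The Boltzmann weight of a state: the product of the weights of its vertices. -/
def stateWeight {n N : ℕ} (s : Decoration n N) : K n N :=
  ∏ i : Fin n, ∏ j : Fin N,
    vertexWeight (x i) (y j) (s.ver i.castSucc j) (s.hor i j.succ) (s.hor i j.castSucc)

open Classical in
/-- The partition function `Z_B`. -/
def partitionFunction {n N : ℕ} (B : Boundary n N) : K n N :=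
  ∑ s ∈ Finset.univ.filter (fun s : Decoration n N => IsState B s), stateWeight s

/-- The boundary conditions `B(σ, w, lam)`: the top edge in column `lam_i` carries the colour
`σ(n + 1 - i)`, the right edge in row `i` has colour `w(i)`, nothing else is coloured. -/
def boundary {n : ℕ} (N : ℕ) (lam : Fin n → ℕ) (σ w : Equiv.Perm (Fin n)) : Boundary n N where
  top j := (Finset.univ.filter (fun i : Fin n => lam i = (j : ℕ) + 1)).image
    (fun i => σ (longest n i))
  bottom _ := ∅
  left _ := none
  right i := some (w i)

/-- The partition function `Z^lam_{σ, w}(x; y)`. -/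
def Z {n : ℕ} (N : ℕ) (lam : Fin n → ℕ) (σ w : Equiv.Perm (Fin n)) : K n N :=
  partitionFunction (boundary N lam σ w)

/-- `∏_i ∏_{j < lam_i} (1 - x_i / y_j)`. -/
def seed {n : ℕ} (N : ℕ) (lam : Fin n → ℕ) : K n N :=
  ∏ i : Fin n, ∏ j ∈ Finset.univ.filter (fun j : Fin N => (j : ℕ) + 1 < lam i),
    (1 - x i / y j)

end

end DoubleWhittaker

namespace DoubleWhittaker

noncomputable section

/-! Fix `σ` and let `w` vary. The partition functions satisfy one recursion, τ_i Z_{σ,w s_i} =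
Z_{σ,w} whenever w(i) < w(i+1) (`tau_Z`). Peeling letters off a reduced word gives τ_w Z_{σ,w} =
Z_{σ,1} for every `w` (`tauWord_Z`). Comparing a general `w` with σw_0 leaves only Z_{σ,σw_0} to
compute; that system has a single state, of weight t^{ℓ(σ)} times the seed (`Z_mono`). Since the
operators are only evaluated on partition functions, arbitrary reduced words are handled without
braid relations for the τ_i.

The recursion comes from a Yang–Baxter equation. Each row is a transfer matrix between layers of
vertical edges, and an R-matrix is pushed through the columns of two adjacent rows
(`rowTransfer_exchange`). On the uncoloured left edges it acts by the scalar X₁ - tX₂; on two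
distinct right colours it gives two terms. These three coefficients are those of τ_i.

Vertical edges carry arbitrary sets, so the equation has to be reduced to a finite check. Each
colour enters at most once from the top and none enters from the left; by conservation, the left
edges and the top set of a column never share or repeat a colour. Under this restriction a weight is
a local part, depending on x/y and the horizontal colours, times products over the top set that
involve one horizontal edge each (`vertexWeight_eq`). For two stacked vertices the set then
contributes a factor symmetric in the two left edges and in the two right edges (`pairWeight_eq`),
and what remains depends only on the relative order of four codes and 0 (`pairCore_exchange`). -/

/-! ### Local weights and the finite Yang–Baxter check -/

/-- The local part of the vertex weight; colours are coded by positive integers and the absence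
of a colour by `0`. -/
def coreWeight {F : Type*} [Field F] (t z : F) (l r : ℕ) : F :=
  if l = r then (if l = 0 then 1 else 1 - z)
  else if l = 0 then -t⁻¹
  else if r = 0 then (t - 1) * z
  else if l < r then -((t - 1) * z * t⁻¹)
  else t - 1

/-- The factor that a colour `e` of the top decoration contributes against the left edge `l`. -/
def coreP {F : Type*} [Field F] (t : F) (l e : ℕ) : F := if l < e then -t else 1

/-- The factor that a colour `e` of the top decoration contributes against the right edge `r`. -/
def coreQ {F : Type*} [Field F] (r e : ℕ) : F := if r ≠ 0 ∧ r < e then -1 else 1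

/-- The coefficients of the `R`-matrix that keep the two horizontal edges. -/
def rDiag {F : Type*} [Field F] (t z₁ z₂ : F) (a b : ℕ) : F :=
  if a = b then z₁ - t * z₂
  else if a = 0 then (1 - t) * z₂
  else if b = 0 then (1 - t) * z₁
  else if a < b then (1 - t) * z₁
  else (1 - t) * z₂

/-- The coefficients of the `R`-matrix that exchange the two horizontal edges. -/
def rSwap {F : Type*} [Field F] (t z₁ z₂ : F) (a b : ℕ) : F :=
  if a = b then 0
  else if a < b then z₂ - z₁
  else t * (z₂ - z₁)

/-- The local part of the weight of two vertices on top of each other. -/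
def pairCore {F : Type*} [Field F] (t z₁ z₂ : F) (a b c d : ℕ) : F :=
  -- The colour on the lower left edge is not available to the upper vertex, so it cannot leave on
  -- the upper right.
  if c = b ∧ b ≠ 0 then 0
  else coreWeight t z₁ a c * coreWeight t z₂ b d * (coreP t b a * (coreP t b c)⁻¹)
    * (coreQ d a * coreQ d c)

set_option maxHeartbeats 20000000 in
/-- The Yang–Baxter equation, reduced to the colours of the horizontal edges. -/
theorem pairCore_exchange {F : Type*} [Field F] {t : F} (ht : t ≠ 0) (z₁ z₂ : F) (a b c d : ℕ)
    (hab : a = b → a = 0) (hcd : c = d → c = 0) :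
    rDiag t z₁ z₂ a b * pairCore t z₂ z₁ a b c d + rSwap t z₁ z₂ a b * pairCore t z₂ z₁ b a c d
      = rDiag t z₁ z₂ c d * pairCore t z₁ z₂ a b c d
        + rSwap t z₁ z₂ d c * pairCore t z₁ z₂ a b d c := by
  unfold rDiag rSwap pairCore coreWeight coreP coreQ
  -- Every conditional is decided by the relative order of `a`, `b`, `c`, `d` and 0; each consistent
  -- order leaves a rational identity.
  rcases lt_trichotomy a b with h1 | h1 | h1 <;>
  rcases lt_trichotomy c d with h2 | h2 | h2 <;>
  rcases lt_trichotomy a c with h3 | h3 | h3 <;>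
  rcases lt_trichotomy b c with h4 | h4 | h4 <;>
  (try (exfalso; omega)) <;>
  rcases lt_trichotomy a d with h5 | h5 | h5 <;>
  (try (exfalso; omega)) <;>
  rcases lt_trichotomy b d with h6 | h6 | h6 <;>
  (try (exfalso; omega)) <;>
  rcases Nat.eq_zero_or_pos a with k1 | k1 <;>
  (try (exfalso; omega)) <;>
  rcases Nat.eq_zero_or_pos b with k2 | k2 <;>
  (try (exfalso; omega)) <;>
  rcases Nat.eq_zero_or_pos c with k3 | k3 <;>
  (try (exfalso; omega)) <;>
  rcases Nat.eq_zero_or_pos d with k4 | k4 <;>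
  (try (exfalso; omega)) <;>
  simp (disch := omega) only [if_pos, if_neg] <;>
  (try field_simp) <;> ring

/-! ### Path sums and products of matrices -/

/-- The sum over all paths of length `m` from `a` to `b`, a step being weighted by the entry of the
corresponding matrix. -/
def pathSum {ι R : Type*} [Fintype ι] [DecidableEq ι] [CommRing R] {m : ℕ}
    (M : Fin m → Matrix ι ι R) (a b : ι) : R :=
  ∑ p : Fin (m + 1) → ι,
    if p 0 = a ∧ p (Fin.last m) = b then ∏ j, M j (p j.castSucc) (p j.succ) else 0

theorem prod_ofFn_apply {ι R : Type*} [Fintype ι] [DecidableEq ι] [CommRing R] {m : ℕ}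
    (M : Fin m → Matrix ι ι R) (a b : ι) : (List.ofFn M).prod a b = pathSum M a b := by
  induction m generalizing a with
  | zero =>
    simp only [List.ofFn_zero, List.prod_nil, pathSum, Matrix.one_apply]
    rw [← (Equiv.funUnique (Fin 1) ι).symm.sum_comp]
    simp only [Finset.univ_eq_empty, Finset.prod_empty]
    rw [Finset.sum_eq_single a]
    · simp [Equiv.funUnique]
    · intro c _ hc
      simp [Equiv.funUnique, hc]
    · simp
  | succ m ih =>
    rw [List.ofFn_succ, List.prod_cons, Matrix.mul_apply]
    simp only [ih]
    unfold pathSum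
    rw [← (Fin.consEquiv (fun _ : Fin (m + 2) => ι)).sum_comp, Fintype.sum_prod_type]
    symm
    rw [Finset.sum_eq_single a]
    · simp only [Finset.mul_sum]
      rw [Finset.sum_comm]
      refine Finset.sum_congr rfl fun p _ => ?_
      symm
      rw [Finset.sum_eq_single (p 0)]
      · simp [Fin.consEquiv, Fin.prod_univ_succ, ← Fin.succ_last]
      · intro c _ hc
        simp [hc.symm]
      · simp
    · intro c _ hc
      refine Finset.sum_eq_zero fun p _ => ?_
      simp [Fin.consEquiv, hc]
    · simp

/-- A walk that is deterministic at every step. -/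
theorem prod_ofFn_of_deterministic {ι R : Type*} [Fintype ι] [DecidableEq ι] [CommRing R] {m : ℕ}
    (M : Fin m → Matrix ι ι R) (u : Fin (m + 1) → ι) (g : Fin m → R)
    (h : ∀ k v, M k (u k.castSucc) v = if v = u k.succ then g k else 0) :
    (List.ofFn M).prod (u 0) (u (Fin.last m)) = ∏ k, g k := by
  induction m with
  | zero => simp
  | succ m ih =>
    rw [List.ofFn_succ, List.prod_cons, Matrix.mul_apply, Fin.prod_univ_succ]
    have h0 := h 0
    simp only [Fin.castSucc_zero] at h0
    simp only [h0, ite_mul, zero_mul, Finset.sum_ite_eq', Finset.mem_univ, if_true]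
    congr 1
    have := ih (fun k => M k.succ) (fun k => u k.succ) (fun k => g k.succ)
      (fun k v => by
        rw [Fin.succ_castSucc]; exact h k.succ v)
    rw [← Fin.succ_last]; exact this

/-- Summing out the intermediate layer of two consecutive path sums. -/
theorem sum_pathSum_mul_pathSum {ι κ R : Type*} [Fintype ι] [DecidableEq ι] [Fintype κ]
    [DecidableEq κ] [CommRing R] {m : ℕ} (A B : Fin m → κ → Matrix ι ι R) (a b c d : ι) :
    ∑ u : Fin m → κ, pathSum (fun j => A j (u j)) a b * pathSum (fun j => B j (u j)) c d
      = pathSum (fun j => (fun p q => ∑ k, A j k p.1 q.1 * B j k p.2 q.2 :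
          Matrix (ι × ι) (ι × ι) R)) (a, c) (b, d) := by
  unfold pathSum
  simp only [Finset.sum_mul_sum]
  rw [Finset.sum_comm]
  rw [← (Equiv.arrowProdEquivProdArrow (Fin (m + 1)) (fun _ => ι) (fun _ => ι)).symm.sum_comp,
    Fintype.sum_prod_type]
  refine Finset.sum_congr rfl fun p _ => ?_
  rw [Finset.sum_comm]
  refine Finset.sum_congr rfl fun q _ => ?_
  simp only [Equiv.arrowProdEquivProdArrow, Equiv.coe_fn_symm_mk, Prod.mk.injEq]
  by_cases h1 : p 0 = a ∧ p (Fin.last m) = b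
  · by_cases h2 : q 0 = c ∧ q (Fin.last m) = d
    · simp only [h1, h2, and_self, if_true, ← Finset.prod_mul_distrib]
      rw [Finset.prod_univ_sum]
      simp
    · simp only [h1, true_and, h2, if_false, mul_zero, Finset.sum_const_zero, and_self]
  · have : ¬ ((p 0 = a ∧ q 0 = c) ∧ p (Fin.last m) = b ∧ q (Fin.last m) = d) := by tauto
    simp only [h1, this, if_false, zero_mul, Finset.sum_const_zero]

/-- The train argument: an element that intertwines the columns one by one passes through the whole
row. -/
theorem prod_ofFn_semiconj {A : Type*} [Monoid A] {m : ℕ} (k : A) (f g : Fin m → A)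
    (h : ∀ j, f j * k = k * g j) : (List.ofFn f).prod * k = k * (List.ofFn g).prod := by
  induction m with
  | zero => simp
  | succ m ih =>
    rw [List.ofFn_succ, List.ofFn_succ, List.prod_cons, List.prod_cons, mul_assoc,
      ih _ _ fun j => h j.succ, ← mul_assoc, h 0, mul_assoc]

/-! ### Factorization of the vertex weights -/

/-- The code of a horizontal decoration: `0` if uncoloured, `c + 1` for the colour `c`. -/
def code {n : ℕ} : Option (Fin n) → ℕ
  | none => 0
  | some c => (c : ℕ) + 1

theorem code_injective {n : ℕ} : Function.Injective (code (n := n)) := by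
  rintro (_ | a) (_ | b) h <;> simp [code, Fin.ext_iff] at h ⊢
  exact h

/-- The product over a vertical decoration of the factors `coreP` against the left edge `l`. -/
def leftFactor {n : ℕ} (N : ℕ) (l : Option (Fin n)) (S : Finset (Fin n)) : K n N :=
  ∏ e ∈ S, coreP (t n N) (code l) ((e : ℕ) + 1)

/-- The product over a vertical decoration of the factors `coreQ` against the right edge `r`. -/
def rightFactor {n : ℕ} (N : ℕ) (r : Option (Fin n)) (S : Finset (Fin n)) : K n N :=
  ∏ e ∈ S, coreQ (code r) ((e : ℕ) + 1)

theorem leftFactor_none {n N : ℕ} (S : Finset (Fin n)) :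
    leftFactor N none S = (-t n N) ^ S.card := by
  simp [leftFactor, coreP, code]

theorem leftFactor_some {n N : ℕ} (S : Finset (Fin n)) (c : Fin n) :
    leftFactor N (some c) S = (-t n N) ^ above S c := by
  simp [leftFactor, coreP, code, above, Finset.prod_ite]

theorem rightFactor_none {n N : ℕ} (S : Finset (Fin n)) : rightFactor N none S = 1 := by
  simp [rightFactor, coreQ, code]

theorem rightFactor_some {n N : ℕ} (S : Finset (Fin n)) (c : Fin n) :
    rightFactor N (some c) S = (-1) ^ above S c := by
  simp [rightFactor, coreQ, code, above, Finset.prod_ite]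

theorem card_eq_below_add_above {n : ℕ} {S : Finset (Fin n)} {c : Fin n} (hc : c ∈ S) :
    S.card = below S c + above S c + 1 := by
  unfold below above
  have h1 : S = (S.filter (fun e => e < c)) ∪ (S.filter (fun e => c < e)) ∪ {c} := by
    ext e
    simp only [Finset.mem_union, Finset.mem_filter, Finset.mem_singleton]
    constructor
    · intro he
      rcases lt_trichotomy e c with h | h | h <;> simp [he, h]
    · rintro ((h | h) | rfl)
      exacts [h.1, h.1, hc]
  conv_lhs => rw [h1]
  rw [Finset.card_union_of_disjoint, Finset.card_union_of_disjoint, Finset.card_singleton]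
  · rw [Finset.disjoint_filter]
    exact fun e _ h1 h2 => absurd h1 h2.not_gt
  · simp

theorem above_eq_between_add_above {n : ℕ} {S : Finset (Fin n)} {c d : Fin n} (hcd : c < d) :
    above S c = between S c d + above S d + if d ∈ S then 1 else 0 := by
  unfold between above
  have h1 : S.filter (fun e => c < e) = (S.filter (fun e => c < e ∧ e < d)) ∪
      (S.filter (fun e => d < e)) ∪ (S.filter (fun e => e = d)) := by
    ext e
    simp only [Finset.mem_union, Finset.mem_filter]
    constructor
    · rintro ⟨he, hc⟩
      rcases lt_trichotomy e d with h | h | h <;> tauto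
    · rintro ((h | h) | h)
      exacts [⟨h.1, h.2.1⟩, ⟨h.1, hcd.trans h.2⟩, ⟨h.1, h.2 ▸ hcd⟩]
  rw [h1, Finset.card_union_of_disjoint, Finset.card_union_of_disjoint]
  · congr 1
    rw [Finset.filter_eq']
    split_ifs <;> simp
  · rw [Finset.disjoint_filter]
    exact fun e _ h1 h2 => absurd h1.2 h2.not_gt
  · rw [← Finset.filter_or, Finset.disjoint_filter]
    rintro e _ (h1 | h1) rfl
    · exact lt_irrefl _ h1.2
    · exact lt_irrefl _ h1

/-- The factorization of the vertex weights. -/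
theorem vertexWeight_eq {n N : ℕ} (X Y : K n N) {S : Finset (Fin n)} {l r : Option (Fin n)}
    (hl : Disjoint l.toFinset S) (hr : r.toFinset ⊆ l.toFinset ∪ S) :
    vertexWeight X Y S l r =
      coreWeight (t n N) (X / Y) (code l) (code r) * leftFactor N l S * rightFactor N r S := by
  have hinv : (t n N)⁻¹ * t n N = 1 := inv_mul_cancel₀ (t_ne_zero n N)
  have hneg : ∀ k : ℕ, (-t n N) ^ k = (-1) ^ k * t n N ^ k := fun k => by rw [← mul_pow]; simp
  have hsq : ∀ k : ℕ, ((-1 : K n N) ^ k) ^ 2 = 1 := fun k => by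
    rw [← pow_mul, mul_comm, pow_mul]; simp
  rcases l with _ | c <;> rcases r with _ | d
  · simp [vertexWeight, coreWeight, code, leftFactor_none, rightFactor_none]
  · have hd : d ∈ S := by simpa using hr
    -- The left factor also counts the colour `d` that leaves, an extra `-t`; this is why
    -- `coreWeight` contains `-t⁻¹`. The same happens below in the case c < d.
    rw [leftFactor_none, rightFactor_some, card_eq_below_add_above hd]
    simp only [vertexWeight, coreWeight, code]
    simp only [Nat.right_eq_add, Nat.add_eq_zero_iff, one_ne_zero, and_false, if_false, if_true,
      hneg, pow_add]
    have h2 := hsq (above S d)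
    linear_combination (-(-1 : K n N) ^ below S d * t n N ^ below S d * t n N ^ above S d) * h2
      - ((-1 : K n N) ^ below S d * t n N ^ below S d * t n N ^ above S d *
        ((-1) ^ above S d) ^ 2) * hinv
  · simp [vertexWeight, coreWeight, code, leftFactor_some, rightFactor_none]
  · have hc : c ∉ S := by simpa using hl
    rw [leftFactor_some, rightFactor_some]
    simp only [vertexWeight, coreWeight, code, Nat.add_right_cancel_iff, Nat.add_eq_zero_iff,
      one_ne_zero, and_false, if_false, Nat.add_lt_add_iff_right, ← Fin.ext_iff, ← Fin.lt_def]
    rcases lt_trichotomy c d with h | rfl | h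
    · have hd : d ∈ S := by
        have : d ∈ (some c).toFinset ∪ S := hr (by simp)
        simpa [h.ne'] using this
      rw [if_neg h.ne, if_pos h, if_neg h.ne, if_pos h, above_eq_between_add_above h, if_pos hd]
      have h2 := hsq (above S d)
      simp only [hneg, pow_add]
      linear_combination
        (-((t n N - 1) * (X / Y) * (-1) ^ between S c d * t n N ^ between S c d *
          t n N ^ above S d)) * h2
        - ((t n N - 1) * (X / Y) * (-1) ^ between S c d * t n N ^ between S c d *
          t n N ^ above S d * ((-1) ^ above S d) ^ 2) * hinv
    · have h2 := hsq (above S c)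
      simp only [if_true, hc, if_false, pow_zero, hneg]
      linear_combination (-t n N ^ above S c * (1 - X / Y)) * h2
    · rw [if_neg h.ne', if_neg h.not_gt, if_neg h.ne', if_neg h.not_gt,
        above_eq_between_add_above h, if_neg hc]
      have h2 := hsq (above S c)
      simp only [hneg, pow_add, pow_zero, mul_one]
      linear_combination (-(t n N - 1) * (-1) ^ between S d c * t n N ^ above S c) * h2

/-! ### Conservation of colours and two stacked vertices -/

/-- The bottom decoration of a vertex at which no colour occurs twice. -/
def outSet {n : ℕ} (l : Option (Fin n)) (S : Finset (Fin n)) (r : Option (Fin n)) :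
    Finset (Fin n) := (l.toFinset ∪ S) \ r.toFinset

/-- Disjointness excludes the second kind of vertex with its colour already in `S`, the only one
whose bottom edge is not given by this set difference. -/
theorem admissibleVertex_iff {n : ℕ} {l r : Option (Fin n)} {S B : Finset (Fin n)}
    (hl : Disjoint l.toFinset S) :
    AdmissibleVertex l S r B ↔ r.toFinset ⊆ l.toFinset ∪ S ∧ B = outSet l S r := by
  constructor
  · rintro (_ | ⟨_, c⟩ | ⟨_, c, hc⟩ | ⟨_, c, hc⟩ | ⟨_, c, d, hcd, hc, hd⟩ | ⟨_, c, d, hcd, hd, hc⟩)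
    · simp [outSet]
    · have hc : c ∉ S := by simpa using hl
      refine ⟨by simp, ?_⟩
      ext e; simp [outSet]
      grind
    · refine ⟨by simpa using hc, ?_⟩
      ext e; simp [outSet]; grind
    · refine ⟨by simp, ?_⟩
      ext e; simp [outSet]
    · refine ⟨by simp [hd], ?_⟩
      ext e; simp [outSet]; grind
    · refine ⟨by simp [hc], ?_⟩
      ext e; simp [outSet]; grind
  · rintro ⟨hr, rfl⟩
    rcases l with _ | c <;> rcases r with _ | d
    · have : outSet none S none = S := by simp [outSet]
      rw [this]; exact .case1 S
    · have hd : d ∈ S := by simpa using hr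
      have : outSet none S (some d) = S.erase d := by ext e; simp [outSet]; grind
      rw [this]; exact .case3 S d hd
    · have hc : c ∉ S := by simpa using hl
      have : outSet (some c) S none = insert c S := by ext e; simp [outSet]
      rw [this]; exact .case4 S c hc
    · have hc : c ∉ S := by simpa using hl
      have hd : d ∈ (some c).toFinset ∪ S := hr (by simp)
      simp only [Option.toFinset_some, Finset.mem_union, Finset.mem_singleton] at hd
      rcases eq_or_ne c d with rfl | hne
      · have : outSet (some c) S (some c) = S := by ext e; simp [outSet]; grind
        rw [this]; exact .case2 S c
      · have hd' : d ∈ S := hd.resolve_left hne.symm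
        have : outSet (some c) S (some d) = (insert c S).erase d := by
          ext e; simp [outSet]; grind
        rw [this]
        rcases hne.lt_or_gt with h | h
        · exact .case5 S c d h hc hd'
        · exact .case6 S d c h hc hd'

theorem AdmissibleVertex.count {n : ℕ} {l r : Option (Fin n)} {S B : Finset (Fin n)}
    (h : AdmissibleVertex l S r B) (e : Fin n) :
    (if e ∈ S then 1 else 0) + (if l = some e then 1 else 0) =
      (if e ∈ B then 1 else 0) + (if r = some e then 1 else 0) := by
  rcases h with _ | ⟨_, c⟩ | ⟨_, c, hc⟩ | ⟨_, c, hc⟩ | ⟨_, c, d, hcd, hc, hd⟩ |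
    ⟨_, c, d, hcd, hd, hc⟩ <;> grind

/-- Multiplicative functions of a vertical set change across a vertex only by the two horizontal
colours. The normalization `g 0 = 1` makes an uncoloured edge contribute nothing. -/
theorem prod_outSet {n : ℕ} {F : Type*} [Field F] (g : ℕ → F) (g0 : g 0 = 1)
    {a c : Option (Fin n)} {S : Finset (Fin n)} (ha : Disjoint a.toFinset S)
    (hc : c.toFinset ⊆ a.toFinset ∪ S) :
    (∏ e ∈ outSet a S c, g ((e : ℕ) + 1)) * g (code c)
      = (∏ e ∈ S, g ((e : ℕ) + 1)) * g (code a) := by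
  have key : ∀ b : Option (Fin n), g (code b) = ∏ e ∈ b.toFinset, g ((e : ℕ) + 1) := by
    rintro (_ | b) <;> simp [code, g0]
  rw [key, key, outSet, Finset.prod_sdiff hc, Finset.prod_union ha, mul_comm]

open Classical in
/-- The weight of a vertex, extended by zero to the vertices that are not admissible. -/
def extWeight {n N : ℕ} (X Y : K n N) (l : Option (Fin n)) (S : Finset (Fin n))
    (r : Option (Fin n)) (B : Finset (Fin n)) : K n N :=
  if AdmissibleVertex l S r B then vertexWeight X Y S l r else 0

/-- The weight of two vertices on top of each other. -/
def pairWeight {n N : ℕ} (X₁ X₂ Y : K n N) (S B : Finset (Fin n)) (c d a b : Option (Fin n)) :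
    K n N := ∑ M, extWeight X₁ Y a S c M * extWeight X₂ Y b M d B

/-- The intermediate set is forced, and it differs from `S` by `a` and `c` only. Hence both the
support condition and the part depending on `S` are symmetric in `a`, `b` and in `c`, `d`, so the
four terms of the Yang–Baxter equation share them. -/
theorem pairWeight_eq {n N : ℕ} (X₁ X₂ Y : K n N) (S B : Finset (Fin n))
    (a b c d : Option (Fin n)) (ha : Disjoint a.toFinset S) (hb : Disjoint b.toFinset S)
    (hab : Disjoint a.toFinset b.toFinset) :
    pairWeight X₁ X₂ Y S B c d a b =
      if Disjoint c.toFinset d.toFinset ∧ c.toFinset ∪ d.toFinset ⊆ a.toFinset ∪ b.toFinset ∪ S ∧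
        B = (a.toFinset ∪ b.toFinset ∪ S) \ (c.toFinset ∪ d.toFinset)
      then leftFactor N a S * leftFactor N b S * (rightFactor N c S * rightFactor N d S) *
        pairCore (t n N) (X₁ / Y) (X₂ / Y) (code a) (code b) (code c) (code d)
      else 0 := by
  have hbo : Disjoint b.toFinset (outSet a S c) := by
    refine Finset.disjoint_of_subset_right Finset.sdiff_subset ?_
    rw [Finset.disjoint_union_right]
    exact ⟨hab.symm, hb⟩
  have hsum : pairWeight X₁ X₂ Y S B c d a b =
      if c.toFinset ⊆ a.toFinset ∪ S then
        vertexWeight X₁ Y S a c * extWeight X₂ Y b (outSet a S c) d B else 0 := by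
    unfold pairWeight
    rw [Finset.sum_eq_single (outSet a S c)]
    · rw [extWeight, admissibleVertex_iff ha]
      simp
    · intro M _ hM
      rw [extWeight, admissibleVertex_iff ha, if_neg (fun h => hM h.2), zero_mul]
    · simp
  rw [hsum, extWeight, admissibleVertex_iff hbo]
  by_cases hc : c.toFinset ⊆ a.toFinset ∪ S
  · rw [if_pos hc]
    have hiff : (d.toFinset ⊆ b.toFinset ∪ outSet a S c ∧ B = outSet b (outSet a S c) d) ↔
        (Disjoint c.toFinset d.toFinset ∧
          c.toFinset ∪ d.toFinset ⊆ a.toFinset ∪ b.toFinset ∪ S ∧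
          B = (a.toFinset ∪ b.toFinset ∪ S) \ (c.toFinset ∪ d.toFinset)) := by
      have hbc : Disjoint b.toFinset c.toFinset := by
        refine Finset.disjoint_of_subset_right hc ?_
        rw [Finset.disjoint_union_right]
        exact ⟨hab.symm, hb⟩
      have hset : outSet b (outSet a S c) d =
          (a.toFinset ∪ b.toFinset ∪ S) \ (c.toFinset ∪ d.toFinset) := by
        rw [Finset.disjoint_left] at hbc
        ext e
        have := @hbc e
        simp only [outSet, Finset.mem_sdiff, Finset.mem_union]
        tauto
      rw [hset, ← and_assoc]
      refine and_congr_left fun _ => ?_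
      constructor
      · intro h
        refine ⟨?_, ?_⟩
        · refine Finset.disjoint_of_subset_right h ?_
          rw [Finset.disjoint_union_right]
          exact ⟨hbc.symm, Finset.disjoint_sdiff⟩
        · refine Finset.union_subset (fun e he => ?_) (fun e he => ?_)
          · have := hc he
            simp only [Finset.mem_union] at this ⊢
            tauto
          · have := h he
            simp only [outSet, Finset.mem_union, Finset.mem_sdiff] at this ⊢
            tauto
      · rintro ⟨h1, h2⟩ e he
        rw [Finset.disjoint_right] at h1
        have := h1 he
        have h3 := h2 (Finset.mem_union_right _ he)
        simp only [outSet, Finset.mem_union, Finset.mem_sdiff] at h3 ⊢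
        tauto
    simp only [hiff]
    split_ifs with hcond
    · have hd := (hiff.2 hcond).1
      have hcb : ¬ (code c = code b ∧ code b ≠ 0) := by
        rintro ⟨h1, h2⟩
        have := code_injective h1
        subst this
        rcases c with _ | c
        · exact h2 rfl
        · have h3 : c ∈ a.toFinset ∪ S := hc (by simp)
          rw [Finset.disjoint_right] at hab
          rw [Finset.disjoint_left] at hb
          rw [Finset.mem_union] at h3
          exact h3.elim (hab (by simp)) (hb (by simp))
      rw [vertexWeight_eq X₁ Y ha hc, vertexWeight_eq X₂ Y hbo hd, pairCore, if_neg hcb]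
      have e1 := prod_outSet (coreP (t n N) (code b)) (by simp [coreP]) ha hc
      have e2 := prod_outSet (F := K n N) (coreQ (code d)) (by simp [coreQ]) ha hc
      have hP : coreP (t n N) (code b) (code c) ≠ 0 := by
        unfold coreP; split_ifs
        · exact neg_ne_zero.2 (t_ne_zero n N)
        · exact one_ne_zero
      -- The values of `coreQ` are signs, so dividing by one is multiplying by it.
      have hQ : coreQ (F := K n N) (code d) (code c) * coreQ (code d) (code c) = 1 := by
        unfold coreQ; split_ifs <;> simp
      have e1' : leftFactor N b (outSet a S c) = leftFactor N b S *
          (coreP (t n N) (code b) (code a) * (coreP (t n N) (code b) (code c))⁻¹) := by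
        rw [← mul_assoc, eq_mul_inv_iff_mul_eq₀ hP]; exact e1
      have e2' : rightFactor N d (outSet a S c) = rightFactor N d S *
          (coreQ (code d) (code a) * coreQ (code d) (code c)) := by
        have e3 : rightFactor N d (outSet a S c) * coreQ (code d) (code c) =
          rightFactor N d S * coreQ (code d) (code a) := e2
        linear_combination coreQ (code d) (code c) * e3 - rightFactor N d (outSet a S c) * hQ
      rw [e1', e2']
      ring
    · simp
  · rw [if_neg hc]
    split_ifs with hcond
    -- A colour available to the pair but not to the upper vertex must be `b`; this is the case in
    -- which `pairCore` vanishes.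
    · have hcb : code c = code b ∧ code b ≠ 0 := by
        rcases c with _ | c
        · simp at hc
        · have h1 : c ∈ a.toFinset ∪ b.toFinset ∪ S := hcond.2.1 (by simp)
          have h2 : c ∉ a.toFinset ∪ S := by simpa using hc
          have h3 : c ∈ b.toFinset := by
            simp only [Finset.mem_union] at h1 h2
            tauto
          rw [Option.mem_toFinset] at h3
          rw [Option.mem_def.1 h3]
          simp [code]
      rw [pairCore, if_pos hcb, mul_zero]
    · rfl

/-! ### Transfer matrices and layers without repeated colours -/

/-- The decoration of the vertical edges between two rows. -/
abbrev Layer (n N : ℕ) : Type := Fin N → Finset (Fin n)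

/-- The weights of the vertices of a row, as matrices from the right to the left edge. -/
def rowMatrix {n N : ℕ} (X : K n N) (U V : Layer n N) (j : Fin N) :
    Matrix (Option (Fin n)) (Option (Fin n)) (K n N) :=
  fun r l => extWeight X (y j) l (U j) r (V j)

/-- The transfer matrix of a row with right edge `c` and uncoloured left edge. -/
def rowTransfer {n N : ℕ} (X : K n N) (c : Option (Fin n)) :
    Matrix (Layer n N) (Layer n N) (K n N) :=
  fun U V => pathSum (rowMatrix X U V) c none

/-- The weights of the columns of two rows. -/
def pairMatrix {n N : ℕ} (X₁ X₂ : K n N) (U V : Layer n N) (j : Fin N) :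
    Matrix (Option (Fin n) × Option (Fin n)) (Option (Fin n) × Option (Fin n)) (K n N) :=
  fun r l => pairWeight X₁ X₂ (y j) (U j) (V j) r.1 r.2 l.1 l.2

/-- The intermediate layer can be summed out column by column, because columns communicate only
through horizontal edges. -/
theorem rowTransfer_mul_apply {n N : ℕ} (X₁ X₂ : K n N) (c d : Option (Fin n))
    (U V : Layer n N) : (rowTransfer X₁ c * rowTransfer X₂ d) U V =
      pathSum (pairMatrix X₁ X₂ U V) (c, d) (none, none) := by
  rw [Matrix.mul_apply]
  exact sum_pathSum_mul_pathSum
    (fun j M r l => extWeight X₁ (y j) l (U j) r M)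
    (fun j M r l => extWeight X₂ (y j) l M r (V j)) c none d none

/-- No colour occurs twice in a layer. -/
def IsFree {n N : ℕ} (U : Layer n N) : Prop := ∀ e, ∑ j, (if e ∈ U j then 1 else 0) ≤ 1

/-- Conservation of colours, summed over the columns to the left of a given place. -/
theorem sum_conservation {N : ℕ} (f : Fin (N + 1) → ℕ) (u v : Fin N → ℕ)
    (h : ∀ j, u j + f j.succ = v j + f j.castSucc) (k : Fin (N + 1)) :
    ∑ j ∈ Finset.univ.filter (fun j : Fin N => (k : ℕ) ≤ j), u j + f (Fin.last N) =
      ∑ j ∈ Finset.univ.filter (fun j : Fin N => (k : ℕ) ≤ j), v j + f k := by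
  induction k using Fin.reverseInduction with
  | last =>
    have : Finset.univ.filter (fun j : Fin N => ((Fin.last N : Fin (N + 1)) : ℕ) ≤ j) = ∅ := by
      rw [Finset.filter_eq_empty_iff]
      intro j _
      simp
    simp only [this, Finset.sum_empty]
  | cast i ih =>
    have hs : Finset.univ.filter (fun j : Fin N => ((i.castSucc : Fin (N + 1)) : ℕ) ≤ j) =
        insert i (Finset.univ.filter (fun j : Fin N => ((i.succ : Fin (N + 1)) : ℕ) ≤ j)) := by
      ext j
      simp only [Finset.mem_filter, Finset.mem_univ, true_and, Finset.mem_insert,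
        Fin.val_castSucc, Fin.val_succ, Fin.ext_iff]
      omega
    have hn : i ∉ Finset.univ.filter (fun j : Fin N => ((i.succ : Fin (N + 1)) : ℕ) ≤ j) := by
      simp
    rw [hs, Finset.sum_insert hn, Finset.sum_insert hn]
    have := h i
    omega

theorem extWeight_ne_zero {n N : ℕ} {X Y : K n N} {l r : Option (Fin n)} {S B : Finset (Fin n)}
    (h : extWeight X Y l S r B ≠ 0) : AdmissibleVertex l S r B := by
  by_contra h'
  exact h (if_neg h')

theorem pairWeight_ne_zero {n N : ℕ} {X₁ X₂ Y : K n N} {a b c d : Option (Fin n)}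
    {S B : Finset (Fin n)} (h : pairWeight X₁ X₂ Y S B c d a b ≠ 0) (e : Fin n) :
    (if e ∈ S then 1 else 0) + ((if a = some e then 1 else 0) + (if b = some e then 1 else 0)) =
      (if e ∈ B then 1 else 0) +
        ((if c = some e then 1 else 0) + (if d = some e then 1 else 0)) := by
  obtain ⟨M, -, hM⟩ := Finset.exists_ne_zero_of_sum_ne_zero h
  have h1 := (extWeight_ne_zero (left_ne_zero_of_mul hM)).count e
  have h2 := (extWeight_ne_zero (right_ne_zero_of_mul hM)).count e
  omega

/-- A summand of a row transfer matrix that does not vanish conserves colours. -/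
theorem row_conservation {n N : ℕ} {X : K n N} {U V : Layer n N} {p : Fin (N + 1) → Option (Fin n)}
    (hp : ∏ j, rowMatrix X U V j (p j.castSucc) (p j.succ) ≠ 0) (e : Fin n) (k : Fin (N + 1)) :
    ∑ j ∈ Finset.univ.filter (fun j : Fin N => (k : ℕ) ≤ j), (if e ∈ U j then 1 else 0) +
        (if p (Fin.last N) = some e then 1 else 0) =
      ∑ j ∈ Finset.univ.filter (fun j : Fin N => (k : ℕ) ≤ j), (if e ∈ V j then 1 else 0) +
        (if p k = some e then 1 else 0) :=
  sum_conservation (fun k => if p k = some e then 1 else 0) (fun j => if e ∈ U j then 1 else 0)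
    (fun j => if e ∈ V j then 1 else 0)
    (fun j => (extWeight_ne_zero (Finset.prod_ne_zero_iff.1 hp j (Finset.mem_univ j))).count e) k

theorem rowTransfer_ne_zero {n N : ℕ} {X : K n N} {c : Option (Fin n)} {U V : Layer n N}
    (h : rowTransfer X c U V ≠ 0) (hU : IsFree U) : IsFree V := by
  intro e
  obtain ⟨p, -, hp⟩ := Finset.exists_ne_zero_of_sum_ne_zero h
  rw [ite_ne_right_iff] at hp
  -- With the left edge uncoloured, conservation across the whole row shows that a colour can only
  -- be lost on the right, never gained.
  have h1 := row_conservation hp.2 e 0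
  have h2 := hU e
  rw [hp.1.2] at h1
  simp at h1 h2 ⊢
  omega

/-- No colour occurs twice at the left edges `l` and in the top decoration `S`. -/
def IsFreePair {n : ℕ} (l : Option (Fin n) × Option (Fin n)) (S : Finset (Fin n)) : Prop :=
  Disjoint l.1.toFinset S ∧ Disjoint l.2.toFinset S ∧ Disjoint l.1.toFinset l.2.toFinset

theorem isFreePair_swap {n : ℕ} {l : Option (Fin n) × Option (Fin n)} {S : Finset (Fin n)} :
    IsFreePair l.swap S ↔ IsFreePair l S := by
  simp only [IsFreePair, Prod.fst_swap, Prod.snd_swap]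
  rw [disjoint_comm (a := l.2.toFinset) (b := l.1.toFinset)]
  tauto

theorem isFreePair_of_count {n : ℕ} {l : Option (Fin n) × Option (Fin n)} {S : Finset (Fin n)}
    (h : ∀ e, (if e ∈ S then 1 else 0) +
      ((if l.1 = some e then 1 else 0) + (if l.2 = some e then 1 else 0)) ≤ 1) :
    IsFreePair l S := by
  refine ⟨?_, ?_, ?_⟩ <;> rw [Finset.disjoint_left] <;> intro e h1 h2 <;>
    have := h e <;> simp_all

open Classical in
/-- `pairMatrix`, restricted to the decorations in which no colour occurs twice. -/
def freeMatrix {n N : ℕ} (X₁ X₂ : K n N) (U V : Layer n N) (j : Fin N) :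
    Matrix (Option (Fin n) × Option (Fin n)) (Option (Fin n) × Option (Fin n)) (K n N) :=
  fun r l => if IsFreePair l (U j) then pairMatrix X₁ X₂ U V j r l else 0

/-- The far left edges are uncoloured, so any colour on the left edges of a column came from the
tops of columns further left. If the top layer is free, such a colour occurs once and is absent from
the top of this column. -/
theorem pathSum_freeMatrix {n N : ℕ} (X₁ X₂ : K n N) {U : Layer n N} (hU : IsFree U)
    (V : Layer n N) (r : Option (Fin n) × Option (Fin n)) :
    pathSum (pairMatrix X₁ X₂ U V) r (none, none) =
      pathSum (freeMatrix X₁ X₂ U V) r (none, none) := by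
  unfold pathSum
  refine Finset.sum_congr rfl fun p _ => ?_
  split_ifs with hp
  swap
  · rfl
  by_cases h0 : ∏ j, pairMatrix X₁ X₂ U V j (p j.castSucc) (p j.succ) = 0
  · rw [h0]
    obtain ⟨j, hj, h0⟩ := Finset.prod_eq_zero_iff.1 h0
    refine (Finset.prod_eq_zero hj ?_).symm
    rw [freeMatrix, h0, ite_self]
  · refine Finset.prod_congr rfl fun j _ => (if_pos ?_).symm
    refine isFreePair_of_count fun e => ?_
    have hc := sum_conservation
      (fun k => (if (p k).1 = some e then 1 else 0) + (if (p k).2 = some e then 1 else 0))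
      (fun j => if e ∈ U j then 1 else 0) (fun j => if e ∈ V j then 1 else 0)
      (fun j => pairWeight_ne_zero (Finset.prod_ne_zero_iff.1 h0 j (Finset.mem_univ j)) e) j.succ
    simp only [hp.2, reduceCtorEq, if_false, add_zero] at hc
    have h1 := hU e
    have hn : j ∉ Finset.univ.filter (fun i : Fin N => ((j.succ : Fin (N + 1)) : ℕ) ≤ i) := by
      simp
    have h2 : (if e ∈ U j then 1 else 0) +
        ∑ i ∈ Finset.univ.filter (fun i : Fin N => ((j.succ : Fin (N + 1)) : ℕ) ≤ i),
          (if e ∈ U i then 1 else 0) ≤ ∑ i, (if e ∈ U i then 1 else 0) := by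
      rw [← Finset.sum_insert (f := fun i => if e ∈ U i then 1 else 0) hn]
      exact Finset.sum_le_sum_of_subset (Finset.subset_univ _)
    omega

/-! ### The R-matrix and the exchange of two rows -/

/-- The (transposed) `R`-matrix. -/
def rMatrix {n N : ℕ} (X₁ X₂ : K n N) :
    Matrix (Option (Fin n) × Option (Fin n)) (Option (Fin n) × Option (Fin n)) (K n N) :=
  fun r r' => (if r' = r then rDiag (t n N) X₁ X₂ (code r.1) (code r.2) else 0) +
    (if r' = r.swap then rSwap (t n N) X₁ X₂ (code r.2) (code r.1) else 0)

theorem mul_rMatrix_apply {n N : ℕ} (X₁ X₂ : K n N)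
    (A : Matrix (Option (Fin n) × Option (Fin n)) (Option (Fin n) × Option (Fin n)) (K n N))
    (r l : Option (Fin n) × Option (Fin n)) :
    (A * rMatrix X₁ X₂) r l = A r l * rDiag (t n N) X₁ X₂ (code l.1) (code l.2) +
      A r l.swap * rSwap (t n N) X₁ X₂ (code l.1) (code l.2) := by
  have hsw : ∀ l' : Option (Fin n) × Option (Fin n), l = l'.swap ↔ l' = l.swap := fun l' =>
    ⟨fun h => by rw [h, Prod.swap_swap], fun h => by rw [h, Prod.swap_swap]⟩
  simp [Matrix.mul_apply, rMatrix, mul_add, Finset.sum_add_distrib, hsw]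

theorem rMatrix_mul_apply {n N : ℕ} (X₁ X₂ : K n N)
    (A : Matrix (Option (Fin n) × Option (Fin n)) (Option (Fin n) × Option (Fin n)) (K n N))
    (r l : Option (Fin n) × Option (Fin n)) :
    (rMatrix X₁ X₂ * A) r l = rDiag (t n N) X₁ X₂ (code r.1) (code r.2) * A r l +
      rSwap (t n N) X₁ X₂ (code r.2) (code r.1) * A r.swap l := by
  simp [Matrix.mul_apply, rMatrix, add_mul, Finset.sum_add_distrib]

theorem rDiag_smul {F : Type*} [Field F] (t k z₁ z₂ : F) (a b : ℕ) :
    rDiag t (k * z₁) (k * z₂) a b = k * rDiag t z₁ z₂ a b := by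
  unfold rDiag; split_ifs <;> ring

theorem rSwap_smul {F : Type*} [Field F] (t k z₁ z₂ : F) (a b : ℕ) :
    rSwap t (k * z₁) (k * z₂) a b = k * rSwap t z₁ z₂ a b := by
  unfold rSwap; split_ifs <;> ring

theorem y_ne_zero {n N : ℕ} (j : Fin N) : (y j : K n N) ≠ 0 := by
  unfold y
  intro h
  exact MvPolynomial.X_ne_zero _
    ((map_eq_zero_iff _ (IsFractionRing.injective _ (K n N))).1 h)

theorem code_eq_of_disjoint {n : ℕ} {a b : Option (Fin n)}
    (h : Disjoint a.toFinset b.toFinset) (hab : code a = code b) : code a = 0 := by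
  obtain rfl := code_injective hab
  rcases a with _ | a
  · rfl
  · simp at h

/-- The Yang–Baxter equation for a column of two rows. -/
theorem freeMatrix_mul_rMatrix {n N : ℕ} (X₁ X₂ : K n N) (U V : Layer n N) (j : Fin N) :
    freeMatrix X₂ X₁ U V j * rMatrix X₁ X₂ = rMatrix X₁ X₂ * freeMatrix X₁ X₂ U V j := by
  ext ⟨c, d⟩ ⟨a, b⟩
  rw [mul_rMatrix_apply, rMatrix_mul_apply]
  by_cases hf : IsFreePair (a, b) (U j)
  swap
  -- The `R`-matrix only keeps or exchanges the left edges, which preserves freeness, so both sides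
  -- vanish on non-free pairs.
  · have hf' := mt isFreePair_swap.1 hf
    simp only [freeMatrix, hf, hf', if_false, zero_mul, mul_zero]
  have hf' := isFreePair_swap.2 hf
  simp only [freeMatrix, hf, hf', if_true]
  obtain ⟨ha, hb, hab⟩ := hf
  simp only [pairMatrix, Prod.swap_prod_mk]
  dsimp only at ha hb hab
  rw [pairWeight_eq _ _ _ _ _ a b c d ha hb hab, pairWeight_eq _ _ _ _ _ b a c d hb ha hab.symm,
    pairWeight_eq _ _ _ _ _ a b c d ha hb hab, pairWeight_eq _ _ _ _ _ a b d c ha hb hab]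
  simp only [disjoint_comm (a := d.toFinset) (b := c.toFinset),
    Finset.union_comm d.toFinset c.toFinset, Finset.union_comm b.toFinset a.toFinset]
  split_ifs with hcond
  · have hY := y_ne_zero (n := n) j
    have key := pairCore_exchange (t_ne_zero n N) (X₁ / y j) (X₂ / y j) (code a) (code b)
      (code c) (code d) (code_eq_of_disjoint hab) (code_eq_of_disjoint hcond.1)
    -- The `R`-coefficients are homogeneous of degree one, so the column parameter scales out and
    -- one `R`-matrix serves all columns.
    have e1 : X₁ = y j * (X₁ / y j) := by field_simp
    have e2 : X₂ = y j * (X₂ / y j) := by field_simp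
    have d1 : ∀ a b, rDiag (t n N) X₁ X₂ a b = y j * rDiag (t n N) (X₁ / y j) (X₂ / y j) a b :=
      fun a b => by rw [← rDiag_smul, ← e1, ← e2]
    have d2 : ∀ a b, rSwap (t n N) X₁ X₂ a b = y j * rSwap (t n N) (X₁ / y j) (X₂ / y j) a b :=
      fun a b => by rw [← rSwap_smul, ← e1, ← e2]
    simp only [d1, d2]
    linear_combination (y j * (leftFactor N a (U j) * leftFactor N b (U j) *
      (rightFactor N c (U j) * rightFactor N d (U j)))) * key
  · simp

/-- The exchange relation for the transfer matrices of two adjacent rows. -/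
theorem rowTransfer_exchange {n N : ℕ} (X₁ X₂ : K n N) {p q : Fin n} (hpq : p < q)
    {U : Layer n N} (hU : IsFree U) (V : Layer n N) :
    (X₁ - t n N * X₂) * (rowTransfer X₂ (some q) * rowTransfer X₁ (some p)) U V =
      (1 - t n N) * X₂ * (rowTransfer X₁ (some q) * rowTransfer X₂ (some p)) U V +
      (X₂ - X₁) * (rowTransfer X₁ (some p) * rowTransfer X₂ (some q)) U V := by
  -- Entry from the right colours (q, p) to uncoloured left edges: the left end yields the scalar,
  -- the right end the two terms.
  have h := congrFun (congrFun (prod_ofFn_semiconj (rMatrix X₁ X₂) _ _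
    (freeMatrix_mul_rMatrix X₁ X₂ U V)) (some q, some p)) (none, none)
  rw [mul_rMatrix_apply, rMatrix_mul_apply] at h
  simp only [prod_ofFn_apply, Prod.swap_prod_mk, ← pathSum_freeMatrix _ _ hU,
    ← rowTransfer_mul_apply] at h
  have hne : ¬ ((q : ℕ) + 1 = p + 1) := fun h => hpq.ne' (Fin.ext (by omega))
  have hne' : ¬ ((p : ℕ) + 1 = q + 1) := fun h => hne h.symm
  have hlt : (p : ℕ) + 1 < q + 1 := by simpa using hpq
  simp only [rDiag, rSwap, code, if_true, mul_zero, add_zero, hne, hne', hlt, hlt.not_gt, if_false,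
    Nat.add_eq_zero_iff, one_ne_zero, and_false] at h
  linear_combination h

/-! ### Partition functions as matrix products and the action of τ_i -/

/-- Once the vertical layers are fixed, the rows are independent, and the sum over horizontal
decorations is a product of path sums. Inadmissible decorations drop out because `extWeight` is zero
on them. -/
theorem partitionFunction_eq_prod {n N : ℕ} (B : Boundary n N) (hB : ∀ i, B.left i = none) :
    partitionFunction B =
      (List.ofFn fun i => rowTransfer (x i) (B.right i)).prod B.top B.bottom := by
  classical
  rw [prod_ofFn_apply]
  unfold partitionFunction pathSum rowTransfer pathSum
  rw [Finset.sum_filter, ← (decorationEquiv n N).symm.sum_comp, Fintype.sum_prod_type,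
    Finset.sum_comm]
  refine Finset.sum_congr rfl fun ver _ => ?_
  simp only [Finset.prod_univ_sum, Fintype.piFinset_univ]
  split_ifs with hv
  · refine Finset.sum_congr rfl fun hor _ => ?_
    by_cases hs : IsState B ⟨hor, ver⟩
    · rw [if_pos (by exact hs)]
      obtain ⟨-, -, h3, h4, h5⟩ := hs
      simp only at h3 h4 h5
      simp only [decorationEquiv, Equiv.coe_fn_symm_mk, stateWeight]
      refine Finset.prod_congr rfl fun i _ => ?_
      rw [if_pos ⟨h4 i, (h3 i).trans (hB i)⟩]
      exact Finset.prod_congr rfl fun j _ => (if_pos (h5 i j)).symm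
    · rw [if_neg (by exact hs)]
      symm
      by_contra h0
      rw [Finset.prod_eq_zero_iff] at h0
      push Not at h0
      refine hs ⟨fun j => congrFun hv.1 j, fun j => congrFun hv.2 j, fun i => ?_, fun i => ?_,
        fun i j => ?_⟩
      · exact ((ite_ne_right_iff.1 (h0 i (Finset.mem_univ i))).1.2).trans (hB i).symm
      · exact (ite_ne_right_iff.1 (h0 i (Finset.mem_univ i))).1.1
      · exact extWeight_ne_zero (Finset.prod_ne_zero_iff.1
          (ite_ne_right_iff.1 (h0 i (Finset.mem_univ i))).2 j (Finset.mem_univ j))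
  · refine Finset.sum_eq_zero fun hor _ => if_neg fun hs => hv ⟨?_, ?_⟩
    · exact funext hs.1
    · exact funext hs.2.1

theorem permX_rowTransfer {n N : ℕ} (s : Equiv.Perm (Fin n)) (i : Fin n) (c : Option (Fin n))
    (U V : Layer n N) :
    permX N s (rowTransfer (x i) c U V) = rowTransfer (x (s i)) c U V := by
  have hv : ∀ (j : Fin N) (S : Finset (Fin n)) (l r : Option (Fin n)),
      permX N s (vertexWeight (x i) (y j) S l r) = vertexWeight (x (s i)) (y j) S l r := by
    intro j S l r
    rcases l with _ | a <;> rcases r with _ | b <;>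
      simp only [vertexWeight, apply_ite (permX N s), map_mul, map_pow, map_neg, map_sub, map_one,
        map_add, map_div₀, permX_x, permX_y, permX_t]
  simp only [rowTransfer, pathSum, map_sum, apply_ite (permX N s), map_prod, map_zero, rowMatrix,
    extWeight, hv]

/-- The variables permute while the colours stay with their rows; thus s_i inside τ_i exchanges two
adjacent row parameters. -/
theorem permX_prod_apply {n N : ℕ} (s : Equiv.Perm (Fin n)) (c : Fin n → Option (Fin n))
    (U V : Layer n N) :
    permX N s ((List.ofFn fun i => rowTransfer (x i) (c i)).prod U V) =
      (List.ofFn fun i => rowTransfer (x (s i)) (c i)).prod U V := by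
  simp only [prod_ofFn_apply, pathSum, map_sum, apply_ite (permX N s), map_prod, map_zero,
    permX_rowTransfer]

theorem prod_ofFn_split {A : Type*} [Monoid A] {n : ℕ} (f : Fin n → A) (i : Fin (n - 1)) :
    (List.ofFn f).prod = ((List.ofFn f).take i).prod *
      ((f (lo i) * f (hi i)) * ((List.ofFn f).drop (i + 2)).prod) := by
  have h1 : (i : ℕ) < (List.ofFn f).length := by rw [List.length_ofFn]; omega
  have h2 : (i : ℕ) + 1 < (List.ofFn f).length := by rw [List.length_ofFn]; omega
  rw [← List.prod_take_mul_prod_drop (List.ofFn f) i, List.drop_eq_getElem_cons h1,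
    List.drop_eq_getElem_cons h2, List.prod_cons, List.prod_cons, mul_assoc (f _)]
  simp only [List.getElem_ofFn]
  rfl

theorem take_ofFn_congr {A : Type*} {n : ℕ} {f g : Fin n → A} {i : Fin (n - 1)}
    (h : ∀ k, k ≠ lo i → k ≠ hi i → f k = g k) :
    (List.ofFn f).take i = (List.ofFn g).take i := by
  refine List.ext_getElem (by simp) fun k h1 h2 => ?_
  simp only [List.length_take, List.length_ofFn] at h1
  simp only [List.getElem_take, List.getElem_ofFn]
  refine h _ (fun h => ?_) (fun h => ?_) <;> simp [lo, hi] at h <;> omega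

theorem drop_ofFn_congr {A : Type*} {n : ℕ} {f g : Fin n → A} {i : Fin (n - 1)}
    (h : ∀ k, k ≠ lo i → k ≠ hi i → f k = g k) :
    (List.ofFn f).drop (i + 2) = (List.ofFn g).drop (i + 2) := by
  refine List.ext_getElem (by simp) fun k h1 h2 => ?_
  simp only [List.getElem_drop, List.getElem_ofFn]
  refine h _ (fun h => ?_) (fun h => ?_) <;> simp [lo, hi] at h <;> omega

theorem prod_preserves_isFree {n N : ℕ}
    (L : List (Matrix (Layer n N) (Layer n N) (K n N)))
    (hL : ∀ A ∈ L, ∀ U V, A U V ≠ 0 → IsFree U → IsFree V) (U V : Layer n N)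
    (h : L.prod U V ≠ 0) (hU : IsFree U) : IsFree V := by
  induction L generalizing U with
  | nil =>
    rw [List.prod_nil, Matrix.one_apply] at h
    exact (ite_ne_right_iff.1 h).1 ▸ hU
  | cons A L ih =>
    rw [List.prod_cons, Matrix.mul_apply] at h
    obtain ⟨W, -, hW⟩ := Finset.exists_ne_zero_of_sum_ne_zero h
    exact ih (fun A hA => hL A (List.mem_cons_of_mem _ hA)) W (right_ne_zero_of_mul hW)
      (hL A List.mem_cons_self U W (left_ne_zero_of_mul hW) hU)

/-- The exchange relation for two adjacent rows of the lattice. -/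
theorem prod_rowTransfer_exchange {n N : ℕ} (w : Equiv.Perm (Fin n)) (i : Fin (n - 1))
    (hw : w (lo i) < w (hi i)) {U : Layer n N} (hU : IsFree U) (V : Layer n N) :
    (x (lo i) - t n N * x (hi i)) * (List.ofFn fun k =>
        rowTransfer (x (simpleRefl i k)) (some ((w * simpleRefl i) k))).prod U V =
      (1 - t n N) * x (hi i) * (List.ofFn fun k =>
        rowTransfer (x k) (some ((w * simpleRefl i) k))).prod U V +
      (x (hi i) - x (lo i)) * (List.ofFn fun k => rowTransfer (x k) (some (w k))).prod U V := by
  have hs : ∀ k, k ≠ lo i → k ≠ hi i → simpleRefl i k = k := fun k h1 h2 =>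
    Equiv.swap_apply_of_ne_of_ne h1 h2
  have hlo : simpleRefl i (lo i) = hi i := Equiv.swap_apply_left _ _
  have hhi : simpleRefl i (hi i) = lo i := Equiv.swap_apply_right _ _
  set f₃ : Fin n → Matrix (Layer n N) (Layer n N) (K n N) :=
    fun k => rowTransfer (x k) (some (w k)) with hf₃
  have h2 : ∀ k, k ≠ lo i → k ≠ hi i →
      rowTransfer (N := N) (x (simpleRefl i k)) (some ((w * simpleRefl i) k)) = f₃ k :=
    fun k h1 h2 => by rw [Equiv.Perm.mul_apply, hs k h1 h2]
  have h1 : ∀ k, k ≠ lo i → k ≠ hi i →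
      rowTransfer (N := N) (x k) (some ((w * simpleRefl i) k)) = f₃ k :=
    fun k h1 h2 => by rw [Equiv.Perm.mul_apply, hs k h1 h2]
  rw [prod_ofFn_split _ i, prod_ofFn_split (fun k => rowTransfer (x k) _) i, prod_ofFn_split f₃ i,
    take_ofFn_congr h2, take_ofFn_congr h1, drop_ofFn_congr h2, drop_ofFn_congr h1]
  simp only [Equiv.Perm.mul_apply, hlo, hhi]
  simp only [Matrix.mul_apply (M := List.prod _), Matrix.mul_apply (N := List.prod _)]
  simp only [Finset.mul_sum, ← Finset.sum_add_distrib]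
  refine Finset.sum_congr rfl fun W _ => Finset.sum_congr rfl fun W' _ => ?_
  -- The exchange relation needs a free layer above the two rows; freeness descends from `U` along
  -- every nonzero contribution.
  by_cases hW : ((List.ofFn f₃).take i).prod U W = 0
  · simp only [hW, zero_mul, mul_zero, add_zero]
  · have hWf : IsFree W := by
      refine prod_preserves_isFree _ (fun A hA => ?_) U W hW hU
      obtain ⟨k, rfl⟩ := (List.mem_ofFn' _ _).1 (List.mem_of_mem_take hA)
      exact fun U V => rowTransfer_ne_zero
    have := rowTransfer_exchange (x (lo i)) (x (hi i)) hw hWf W'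
    linear_combination (((List.ofFn f₃).take i).prod U W *
      ((List.ofFn f₃).drop (i + 2)).prod W' V) * this

/-- The top decoration of the lattice. -/
def topLayer {n : ℕ} (N : ℕ) (lam : Fin n → ℕ) (σ : Equiv.Perm (Fin n)) : Layer n N := fun j =>
  (Finset.univ.filter (fun i : Fin n => lam i = (j : ℕ) + 1)).image (fun i => σ (longest n i))

theorem Z_eq_prod {n N : ℕ} (lam : Fin n → ℕ) (σ w : Equiv.Perm (Fin n)) :
    Z N lam σ w = (List.ofFn fun i => rowTransfer (x i) (some (w i))).prod (topLayer N lam σ)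
      (fun _ => ∅) :=
  partitionFunction_eq_prod (boundary N lam σ w) fun _ => rfl

theorem mem_topLayer {n N : ℕ} {lam : Fin n → ℕ} {σ : Equiv.Perm (Fin n)} {j : Fin N}
    {i : Fin n} : σ (longest n i) ∈ topLayer N lam σ j ↔ lam i = (j : ℕ) + 1 := by
  simp [topLayer]

theorem isFree_topLayer {n N : ℕ} (lam : Fin n → ℕ) (σ : Equiv.Perm (Fin n)) :
    IsFree (topLayer N lam σ) := by
  intro e
  obtain ⟨i, rfl⟩ := ((longest n).trans σ).surjective e
  simp only [Equiv.trans_apply, mem_topLayer]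
  rw [Finset.sum_boole, Nat.cast_id, Finset.card_le_one]
  intro a ha b hb
  simp only [Finset.mem_filter, Finset.mem_univ, true_and] at ha hb
  exact Fin.ext (by omega)

/-- The action of `τ_i` on the partition functions. -/
theorem tau_Z {n N : ℕ} (lam : Fin n → ℕ) (σ w : Equiv.Perm (Fin n)) (i : Fin (n - 1))
    (hw : w (lo i) < w (hi i)) : tau N i (Z N lam σ (w * simpleRefl i)) = Z N lam σ w := by
  have h := prod_rowTransfer_exchange w i hw (isFree_topLayer lam σ) (fun _ : Fin N => ∅)
  rw [← permX_prod_apply (simpleRefl i) (fun k => some ((w * simpleRefl i) k)), ← Z_eq_prod,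
    ← Z_eq_prod] at h
  change tauFun N i _ = _
  have h1 := one_sub_xroot_ne_zero (N := N) i
  have hx : (x (hi i) : K n N) ≠ 0 := x_ne_zero _
  have e : x (lo i) = xroot N i * x (hi i) := by unfold xroot; field_simp
  rw [e] at h
  have h' : (xroot N i - t n N) * permX N (simpleRefl i) (Z N lam σ (w * simpleRefl i)) =
      (1 - t n N) * Z N lam σ (w * simpleRefl i) + (1 - xroot N i) * Z N lam σ w := by
    apply mul_left_cancel₀ hx
    linear_combination h
  unfold tauFun
  field_simp
  linear_combination h'

/-! ### The system with a single state -/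

/-- A permutation of maximal length in its coset increases along the rows that start in the same
column. -/
theorem IsMaxCosetRep.lt {n : ℕ} {lam : Fin n → ℕ} {σ : Equiv.Perm (Fin n)}
    (hanti : Antitone lam) (hσ : IsMaxCosetRep lam σ) {i k : Fin n} (hik : i < k)
    (hlam : lam i = lam k) : σ (longest n i) < σ (longest n k) := by
  have hstep : ∀ m : Fin (n - 1), lam (longest n (lo m)) = lam (longest n (hi m)) →
      σ (hi m) < σ (lo m) := by
    intro m hm
    by_contra hlt
    have hlt' : σ (lo m) < σ (hi m) :=
      lt_of_le_of_ne (not_lt.1 hlt) (σ.injective.ne (lo_ne_hi m))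
    have hstab : StabilizesRev lam (simpleRefl m) := by
      intro j
      rw [simpleRefl, Equiv.swap_apply_def]
      split_ifs with h1 h2
      · rw [h1, hm]
      · rw [h2, hm]
      · rfl
    have h1 := hσ _ hstab
    have h2 := len_mul_simpleRefl (σ * simpleRefl m) m (by simpa [simpleRefl] using hlt')
    have h3 : σ * simpleRefl m * simpleRefl m = σ := by simp [mul_assoc, simpleRefl]
    rw [h3] at h2
    omega
  have hadj : ∀ a b : Fin n, (b : ℕ) = a + 1 → lam a = lam b →
      σ (longest n a) < σ (longest n b) := by
    intro a b hb hab
    -- Reversal sends the neighbours a, a + 1 to neighbouring positions in the opposite order, of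
    -- which the smaller is n - 2 - a.
    have hm : n - 2 - (a : ℕ) < n - 1 := by omega
    have h1 : longest n b = lo ⟨n - 2 - a, hm⟩ := by
      ext; simp [longest, lo, Fin.val_rev]; omega
    have h2 : longest n a = hi ⟨n - 2 - a, hm⟩ := by
      ext; simp [longest, hi, Fin.val_rev]; omega
    have hinv : ∀ j, longest n (longest n j) = j := fun j => by simp [longest]
    rw [h1, h2]
    refine hstep _ ?_
    rw [← h1, ← h2, hinv, hinv, hab]
  have hdist : ∀ d : ℕ, ∀ i k : Fin n, (k : ℕ) = i + 1 + d → lam i = lam k →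
      σ (longest n i) < σ (longest n k) := by
    intro d
    induction d with
    | zero => exact hadj
    | succ d ih =>
      intro i k hk hl
      have hm : (i : ℕ) + 1 < n := by omega
      have l1 : lam ⟨i + 1, hm⟩ ≤ lam i := hanti (by simp [Fin.le_def])
      have l2 : lam k ≤ lam ⟨i + 1, hm⟩ := hanti (by simp [Fin.le_def]; omega)
      exact (hadj i ⟨i + 1, hm⟩ rfl (by omega)).trans
        (ih ⟨i + 1, hm⟩ k (by simp; omega) (by omega))
  exact hdist (k - i - 1) i k (by have := Fin.lt_def.1 hik; omega) hlam

/-- The layer above row `k` when every row has taken its colour out of its own column. -/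
def monoLayer {n : ℕ} (N : ℕ) (lam : Fin n → ℕ) (σ : Equiv.Perm (Fin n)) (k : Fin (n + 1)) :
    Layer n N := fun j =>
  (Finset.univ.filter (fun i : Fin n => (k : ℕ) ≤ i ∧ lam i = (j : ℕ) + 1)).image
    (fun i => σ (longest n i))

theorem mem_monoLayer {n N : ℕ} {lam : Fin n → ℕ} {σ : Equiv.Perm (Fin n)} {k : Fin (n + 1)}
    {j : Fin N} {i : Fin n} :
    σ (longest n i) ∈ monoLayer N lam σ k j ↔ (k : ℕ) ≤ i ∧ lam i = (j : ℕ) + 1 := by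
  simp [monoLayer]

/-- The horizontal decoration of row `k` in the only state. -/
def monoPath {n : ℕ} (N : ℕ) (lam : Fin n → ℕ) (σ : Equiv.Perm (Fin n)) (k : Fin n)
    (j : Fin (N + 1)) : Option (Fin n) := if (j : ℕ) < lam k then some (σ (longest n k)) else none

theorem monoLayer_eq_empty {n N : ℕ} {lam : Fin n → ℕ} (hanti : Antitone lam)
    (σ : Equiv.Perm (Fin n)) (k : Fin n) {j : Fin N} (hj : lam k ≤ j) :
    monoLayer N lam σ k.castSucc j = ∅ := by
  unfold monoLayer
  rw [Finset.image_eq_empty, Finset.filter_eq_empty_iff]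
  rintro i - ⟨h1, h2⟩
  have := hanti (show k ≤ i from h1)
  omega

/-- A row of the monostatic system has only one admissible horizontal decoration. -/
theorem eq_monoPath {n N : ℕ} {lam : Fin n → ℕ} (hanti : Antitone lam)
    (hpos : ∀ i, 0 < lam i) (hN : ∀ i, lam i ≤ N) (σ : Equiv.Perm (Fin n)) (k : Fin n) {X : K n N}
    {V : Layer n N} {p : Fin (N + 1) → Option (Fin n)} (h0 : p 0 = some (σ (longest n k)))
    (hlast : p (Fin.last N) = none)
    (hp : ∏ j, rowMatrix X (monoLayer N lam σ k.castSucc) V j (p j.castSucc) (p j.succ) ≠ 0) :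
    p = monoPath N lam σ k := by
  have hsum : ∀ m : Fin (N + 1), (m : ℕ) < lam k →
      ∑ j ∈ Finset.univ.filter (fun j : Fin N => (m : ℕ) ≤ j),
        (if σ (longest n k) ∈ monoLayer N lam σ k.castSucc j then 1 else 0) = 1 := by
    intro m hm
    have := hpos k
    have := hN k
    -- Parts are not shifted but columns are: row `k` has its colour on top of the zero-based column
    -- `lam k - 1`.
    rw [Finset.sum_eq_single ⟨lam k - 1, by omega⟩]
    · refine if_pos (mem_monoLayer.2 ⟨le_rfl, ?_⟩)
      simp
      omega
    · intro j _ hj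
      refine if_neg fun hmem => hj ?_
      have h := (mem_monoLayer.1 hmem).2
      exact (Fin.ext (by simp; omega))
    · intro h
      simp at h
      omega
  -- The colour is present once above and leaves on the right, so it occurs nowhere in `V`; at an
  -- edge right of its column it therefore has to be on the horizontal edge.
  have hz := row_conservation hp (σ (longest n k)) 0
  rw [hsum 0 (hpos k), hlast, if_pos h0] at hz
  simp only [reduceCtorEq, if_false] at hz
  funext m
  unfold monoPath
  split_ifs with hm
  · have h1 := row_conservation hp (σ (longest n k)) m
    rw [hsum m hm, hlast] at h1
    have h2 : ∑ j ∈ Finset.univ.filter (fun j : Fin N => (m : ℕ) ≤ j),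
        (if σ (longest n k) ∈ V j then 1 else 0) ≤
        ∑ j ∈ Finset.univ.filter (fun j : Fin N => ((0 : Fin (N + 1)) : ℕ) ≤ j),
        (if σ (longest n k) ∈ V j then 1 else 0) := by
      refine Finset.sum_le_sum_of_subset fun j _ => ?_
      simp
    by_contra hne
    rw [if_neg hne] at h1
    simp only [reduceCtorEq, if_false] at h1
    omega
  · rcases hpm : p m with _ | e
    · rfl
    -- Left of the column of row `k` the top layer is empty by monotonicity of `lam`, so no colour
    -- can reach this edge.
    · have h1 := row_conservation hp e m
      rw [hlast, if_pos hpm, Finset.sum_eq_zero] at h1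
      · simp at h1
      · intro j hj
        have hj' : (m : ℕ) ≤ j := (Finset.mem_filter.1 hj).2
        rw [monoLayer_eq_empty hanti σ k (by omega)]
        simp

theorem rowTransfer_monoLayer {n N : ℕ} {lam : Fin n → ℕ} (hanti : Antitone lam)
    (hpos : ∀ i, 0 < lam i) (hN : ∀ i, lam i ≤ N) (σ : Equiv.Perm (Fin n)) (k : Fin n) (X : K n N)
    (V : Layer n N) :
    rowTransfer X (some (σ (longest n k))) (monoLayer N lam σ k.castSucc) V =
      if V = monoLayer N lam σ k.succ then
        ∏ j, vertexWeight X (y j) (monoLayer N lam σ k.castSucc j)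
          (monoPath N lam σ k j.succ) (monoPath N lam σ k j.castSucc)
      else 0 := by
  have hadm : ∀ j : Fin N, AdmissibleVertex (monoPath N lam σ k j.succ)
      (monoLayer N lam σ k.castSucc j) (monoPath N lam σ k j.castSucc) (V j) ↔
      V j = monoLayer N lam σ k.succ j := by
    intro j
    have hmem := mem_monoLayer (N := N) (lam := lam) (σ := σ) (k := k.castSucc) (j := j) (i := k)
    simp only [Fin.val_castSucc, le_refl, true_and] at hmem
    have hsucc : ∀ e, e ∈ monoLayer N lam σ k.succ j ↔
        e ∈ monoLayer N lam σ k.castSucc j ∧ e ≠ σ (longest n k) := by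
      intro e
      obtain ⟨i, rfl⟩ := ((longest n).trans σ).surjective e
      simp only [Equiv.trans_apply, mem_monoLayer, ne_eq, EmbeddingLike.apply_eq_iff_eq,
        Fin.val_castSucc, Fin.val_succ, Fin.ext_iff]
      omega
    have hd : Disjoint (monoPath N lam σ k j.succ).toFinset (monoLayer N lam σ k.castSucc j) := by
      unfold monoPath
      split_ifs with h
      · rw [Option.toFinset_some, Finset.disjoint_singleton_left, hmem]
        simp at h
        omega
      · simp
    rw [admissibleVertex_iff hd]
    have hsub : (monoPath N lam σ k j.castSucc).toFinset ⊆
        (monoPath N lam σ k j.succ).toFinset ∪ monoLayer N lam σ k.castSucc j := by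
      unfold monoPath
      by_cases h1 : (j : ℕ) + 1 < lam k
      · simp [h1, (Nat.lt_succ_self _).trans h1]
      · by_cases h2 : (j : ℕ) < lam k
        · have := hmem.2 (by omega)
          simp [h1, h2, this]
        · simp [h2]
    rw [and_iff_right hsub]
    have hout : outSet (monoPath N lam σ k j.succ) (monoLayer N lam σ k.castSucc j)
        (monoPath N lam σ k j.castSucc) = monoLayer N lam σ k.succ j := by
      ext e
      rw [hsucc]
      unfold outSet monoPath
      by_cases h1 : (j : ℕ) + 1 < lam k
      · simp [h1, (Nat.lt_succ_self _).trans h1]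
        tauto
      · by_cases h2 : (j : ℕ) < lam k
        · simp [h1, h2]
        · simp [h1, h2]
          rintro h rfl
          rw [hmem] at h
          omega
    rw [hout]
  rw [rowTransfer, pathSum, Finset.sum_eq_single (monoPath N lam σ k)]
  · have h0 : monoPath N lam σ k 0 = some (σ (longest n k)) := by simp [monoPath, hpos]
    have hlast : monoPath N lam σ k (Fin.last N) = none := by simp [monoPath, hN]
    rw [if_pos ⟨h0, hlast⟩]
    simp only [rowMatrix, extWeight, hadm]
    split_ifs with hV
    · exact Finset.prod_congr rfl fun j _ => if_pos (congrFun hV j)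
    · obtain ⟨j, hj⟩ := Function.ne_iff.1 hV
      exact Finset.prod_eq_zero (Finset.mem_univ j) (if_neg hj)
  · intro p _ hne
    rw [ite_eq_right_iff]
    rintro ⟨h0, hlast⟩
    by_contra hp
    exact hne (eq_monoPath hanti hpos hN σ k h0 hlast hp)
  · simp

theorem vertexWeight_mono {n N : ℕ} {lam : Fin n → ℕ} (hanti : Antitone lam)
    {σ : Equiv.Perm (Fin n)} (hσ : IsMaxCosetRep lam σ) (k : Fin n) (X : K n N) (j : Fin N) :
    vertexWeight X (y j) (monoLayer N lam σ k.castSucc j) (monoPath N lam σ k j.succ)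
        (monoPath N lam σ k j.castSucc) =
      t n N ^ above (monoLayer N lam σ k.castSucc j) (σ (longest n k)) *
        if (j : ℕ) + 1 < lam k then 1 - X / y j else 1 := by
  have hmem := mem_monoLayer (N := N) (lam := lam) (σ := σ) (k := k.castSucc) (j := j) (i := k)
  simp only [Fin.val_castSucc, le_refl, true_and] at hmem
  unfold monoPath
  by_cases h1 : (j : ℕ) + 1 < lam k
  · have h3 : σ (longest n k) ∉ monoLayer N lam σ k.castSucc j := by rw [hmem]; omega
    simp [h1, (Nat.lt_succ_self _).trans h1, vertexWeight, h3]
    left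
    ring
  · by_cases h2 : (j : ℕ) < lam k
    -- This is where maximality of `σ` enters: the colours still waiting in this column are all
    -- larger, so the signed power of `t` is trivial.
    · have hb : below (monoLayer N lam σ k.castSucc j) (σ (longest n k)) = 0 := by
        unfold below
        rw [Finset.card_eq_zero, Finset.filter_eq_empty_iff]
        intro e he
        obtain ⟨i, rfl⟩ := ((longest n).trans σ).surjective e
        simp only [Equiv.trans_apply] at he ⊢
        rw [mem_monoLayer] at he
        rcases eq_or_lt_of_le (show k ≤ i from he.1) with rfl | hlt
        · exact lt_irrefl _
        · exact (hσ.lt hanti hlt (by omega)).not_gt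
      simp [h1, h2, vertexWeight, hb]
    · rw [monoLayer_eq_empty hanti σ k (by omega)]
      simp [h1, h2, vertexWeight, above]

/-- A larger colour still waiting above row `k` belongs to a later row and sits in exactly one
column. After reversal of the indices such pairs of rows are the inversions of `σ`. -/
theorem sum_above_monoLayer {n N : ℕ} {lam : Fin n → ℕ} (hpos : ∀ i, 0 < lam i)
    (hN : ∀ i, lam i ≤ N) (σ : Equiv.Perm (Fin n)) :
    ∑ k : Fin n, ∑ j, above (monoLayer N lam σ k.castSucc j) (σ (longest n k)) = len σ := by
  have h1 : ∀ k : Fin n, ∑ j, above (monoLayer N lam σ k.castSucc j) (σ (longest n k)) =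
      ∑ i : Fin n, if k < i ∧ σ (longest n k) < σ (longest n i) then 1 else 0 := by
    intro k
    have h2 : ∀ j : Fin N, above (monoLayer N lam σ k.castSucc j) (σ (longest n k)) =
        ∑ i : Fin n, if (k ≤ i ∧ lam i = (j : ℕ) + 1) ∧ σ (longest n k) < σ (longest n i)
          then 1 else 0 := by
      intro j
      rw [Finset.sum_boole, Nat.cast_id, above, monoLayer, Finset.filter_image,
        Finset.card_image_of_injective _ (show Function.Injective fun i => σ (longest n i) from
          σ.injective.comp (longest n).injective),
        Finset.filter_filter]
      rfl
    simp only [h2]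
    rw [Finset.sum_comm]
    refine Finset.sum_congr rfl fun i _ => ?_
    have := hpos i
    have := hN i
    rw [Finset.sum_eq_single ⟨lam i - 1, by omega⟩]
    · refine if_congr ?_ rfl rfl
      constructor
      · rintro ⟨⟨h1, -⟩, h2⟩
        refine ⟨lt_of_le_of_ne h1 ?_, h2⟩
        rintro rfl
        exact lt_irrefl _ h2
      · rintro ⟨h1, h2⟩
        exact ⟨⟨h1.le, by simp; omega⟩, h2⟩
    · intro j _ hj
      rw [if_neg]
      rintro ⟨⟨-, h⟩, -⟩
      exact hj (Fin.ext (by simp; omega))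
    · simp
  simp only [h1]
  symm
  rw [len, ← Nat.cast_id (Finset.card _), ← Finset.sum_boole, Fintype.sum_prod_type,
    Finset.sum_comm, ← Equiv.sum_comp (longest n)]
  refine Finset.sum_congr rfl fun k _ => ?_
  rw [← Equiv.sum_comp (longest n)]
  refine Finset.sum_congr rfl fun i _ => ?_
  simp [longest]

/-- The partition function of the monostatic system. -/
theorem Z_mono {n N : ℕ} {lam : Fin n → ℕ} (hanti : Antitone lam) (hpos : ∀ i, 0 < lam i)
    (hN : ∀ i, lam i ≤ N) {σ : Equiv.Perm (Fin n)} (hσ : IsMaxCosetRep lam σ) :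
    Z N lam σ (σ * longest n) = t n N ^ len σ * seed N lam := by
  have htop : topLayer N lam σ = monoLayer N lam σ 0 := by
    funext j; simp [topLayer, monoLayer]
  have hbot : (fun _ => ∅ : Layer n N) = monoLayer N lam σ (Fin.last n) := by
    funext j
    symm
    unfold monoLayer
    rw [Finset.image_eq_empty, Finset.filter_eq_empty_iff]
    rintro i - ⟨h, -⟩
    simp at h
    omega
  rw [Z_eq_prod, htop, hbot]
  refine (prod_ofFn_of_deterministic _ (monoLayer N lam σ) _ fun k V =>
    rowTransfer_monoLayer hanti hpos hN σ k (x k) V).trans ?_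
  simp only [vertexWeight_mono hanti hσ, Finset.prod_mul_distrib, Finset.prod_pow_eq_pow_sum,
    sum_above_monoLayer hpos hN σ, seed, Finset.prod_filter]

/-! ### Reduced words and conclusion -/

theorem len_one {n : ℕ} : len (1 : Equiv.Perm (Fin n)) = 0 := by
  rw [len, Finset.card_eq_zero, Finset.filter_eq_empty_iff]
  rintro ⟨p, q⟩ -
  exact fun h => absurd h.1 h.2.not_gt

theorem len_mul_simpleRefl_of_lt {n : ℕ} (w : Equiv.Perm (Fin n)) (i : Fin (n - 1))
    (h : w (lo i) < w (hi i)) : len (w * simpleRefl i) = len w + 1 := by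
  have h2 := len_mul_simpleRefl (w * simpleRefl i) i (by simpa [simpleRefl] using h)
  rwa [show w * simpleRefl i * simpleRefl i = w by simp [mul_assoc, simpleRefl]] at h2

/-- Each letter changes the length by exactly one. The bound makes prefixes of reduced words
reduced. -/
theorem len_prod_le {n : ℕ} (a : List (Fin (n - 1))) : len (a.map simpleRefl).prod ≤ a.length := by
  induction a using List.reverseRecOn with
  | nil => simp [len_one]
  | append_singleton a i ih =>
    rw [List.map_append, List.prod_append, List.map_singleton, List.prod_singleton,
      List.length_append, List.length_singleton]
    set v := (a.map simpleRefl).prod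
    rcases lt_or_gt_of_ne (v.injective.ne (lo_ne_hi i)) with h | h
    · rw [len_mul_simpleRefl_of_lt v i h]; omega
    · have := len_mul_simpleRefl v i h; omega

/-- The last letter of a reduced word is an ascent of the prefix `v`, so τ_i takes the function of v
s_i to that of `v`, and induction applies to `v`. The value no longer depends on `w`, which links
any two right boundary conditions. -/
theorem tauWord_Z {n N : ℕ} (lam : Fin n → ℕ) (σ : Equiv.Perm (Fin n)) (a : List (Fin (n - 1)))
    (w : Equiv.Perm (Fin n)) (ha : IsReducedWord w a) :
    tauWord N a (Z N lam σ w) = Z N lam σ 1 := by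
  induction a using List.reverseRecOn generalizing w with
  | nil =>
    obtain rfl : 1 = w := by simpa using ha.1
    simp [tauWord]
  | append_singleton a i ih =>
    obtain ⟨h1, h2⟩ := ha
    rw [List.map_append, List.prod_append, List.map_singleton, List.prod_singleton] at h1
    rw [List.length_append, List.length_singleton, ← h1] at h2
    set v := (a.map simpleRefl).prod with hv
    have hle : len v ≤ a.length := len_prod_le a
    have hlt : v (lo i) < v (hi i) := by
      rcases lt_or_gt_of_ne (v.injective.ne (lo_ne_hi i)) with h | h
      · exact h
      · have := len_mul_simpleRefl v i h
        omega
    rw [len_mul_simpleRefl_of_lt v i hlt] at h2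
    have hz := ih v ⟨rfl, by omega⟩
    rw [← hz, ← tau_Z lam σ v i hlt, h1]
    simp [tauWord]

theorem tauWord_t_pow_mul {n N : ℕ} (a : List (Fin (n - 1))) (k : ℕ) (f : K n N) :
    tauWord N a (t n N ^ k * f) = t n N ^ k * tauWord N a f := by
  have h : ∀ g : K n N, t n N ^ k * g = (RatFunc.X ^ k : RatFunc ℂ) • g := fun g => by
    rw [Algebra.smul_def, map_pow]; rfl
  rw [h, h, map_smul]

end

end DoubleWhittaker

theorem theorem4p5 (n N : ℕ) (lam : Fin n → ℕ) (hanti : Antitone lam)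
    (hpos : ∀ i, 0 < lam i) (hN : ∀ i, lam i ≤ N) (σ w : Equiv.Perm (Fin n))
    (hσ : DoubleWhittaker.IsMaxCosetRep lam σ)
    (a b : List (Fin (n - 1)))
    (ha : DoubleWhittaker.IsReducedWord w a)
    (hb : DoubleWhittaker.IsReducedWord (σ * DoubleWhittaker.longest n) b) :
    DoubleWhittaker.Z N lam σ w =
      DoubleWhittaker.t n N ^ DoubleWhittaker.len σ *
        (DoubleWhittaker.tauWord N a)⁻¹
          (DoubleWhittaker.tauWord N b (DoubleWhittaker.seed N lam)) := by
  have h1 := DoubleWhittaker.tauWord_Z (N := N) lam σ a w ha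
  have h2 := DoubleWhittaker.tauWord_Z (N := N) lam σ b _ hb
  rw [DoubleWhittaker.Z_mono hanti hpos hN hσ, DoubleWhittaker.tauWord_t_pow_mul] at h2
  -- After τ_w is applied, both sides equal Z_{σ,1}; the power of `t` passes through by linearity
  -- over ℂ(t).
  apply (DoubleWhittaker.tauWord N a).injective
  rw [h1, DoubleWhittaker.tauWord_t_pow_mul, ← LinearEquiv.mul_apply, mul_inv_cancel, ← h2]
  rfl
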